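/- Let $K$ be an algebraically closed field (of any characteristic), $R=K[x_0,x_1,x_2]$, and let $Z=m_1p_1+\cdots+m_sp_s$ be a fat point scheme in $\mathbb P^2_K$, that is, the scheme defined by $I_Z=\bigcap_i I_{p_i}^{m_i}\subseteq R$ for distinct points $p_i$ and integers $m_i\ge 0$, where $I_{p_i}$ is generated by the forms vanishing at $p_i$. Let $h_Z(t)=\dim_K (R/I_Z)_t$ for integers $t\ge 0$. Let $L_1,\dots,L_r$ ($r\ge 0$) be lines, not necessarily distinct, with defining linear forms $F_1,\dots,F_r$; put $Z_0=Z$, and let $Z_j$ be the residual scheme defined by $I_{Z_j}=(I_{Z_{j-1}}:F_j)$. Put $d_j=\deg(L_j\cap Z_{j-1})$. Assume that the lines totally reduce $Z$, i.e. $Z_r=\varnothing$; then $\mathbf d=(d_1,\dots,d_r)$ is called a full reduction vector of $Z$. For a vector $\mathbf d$ of non-negative integers and an integer $t\ge 0$ set $$f_{\mathbf d}(t)=\sum_{i=0}^{r-1}\binom{\min(t-i+1,\,d_{i+1})}{1},\qquad F_{\mathbf d}(t)=\min_{0\le i\le r}\left(\binom{t+2}{2}-\binom{t-i+2}{2}+\sum_{i<j\le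 r}d_j\right),$$ where binomial coefficients with negative upper entry are $0$. (1) For all $t\ge 0$, $f_{\mathbf d}(t)\le h_Z(t)\le F_{\mathbf d}(t)$. (2) If $d_1\ge d_2\ge\cdots\ge d_r>0$, then $f_{\mathbf d}=F_{\mathbf d}$ unless $\mathbf d$ contains consecutive entries of the form $(a,a,a)$, or consecutive entries $(d_i,\dots,d_{i+j+1})$ with $j>1$ such that $d_i=d_{i+1}$, $d_{i+j}=d_{i+j+1}$, and $d_{i+1},\dots,d_{i+j}$ are consecutive integers. (3) If $d_1>d_2>\cdots>d_r>0$, then $\mathbf d$ uniquely determines the graded Betti numbers of $I_Z$: there are sequences $\nu=(\nu_j)_{j\ge0}$ and $\sigma=(\sigma_j)_{j\ge0}$ of non-negative integers, depending only on $\mathbf d$, such that for every fat point scheme $Z$ in the projective plane (over any algebraically closed field) with full reduction vector $\mathbf d$, the ideal $I_Z$ has a minimal graded free resolution $$0\to\bigoplus_{j}R[-j]^{\sigma_j}\to\bigoplus_{j}R[-j]^{\nu_j}\to I_Z\to0,$$ and every minimal graded free resolution of $I_Z$ of this form has these same exponents. -/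

import Mathlib

open scoped LinearAlgebra.Projectivization

universe u

namespace FatPoints

/-- The homogeneous coordinate ring `K[x₀, x₁, x₂]` of the projective plane. -/
abbrev Coord (K : Type u) [Field K] : Type u := MvPolynomial (Fin 3) K

/-- The points of the projective plane over `K`. -/
abbrev Plane (K : Type u) [Field K] : Type u := ℙ K (Fin 3 → K)

section

variable {K : Type u} [Field K]

/-- The ideal generated by all forms that vanish at `p`. (For a form, vanishing does not depend
on the choice of the representative of `p`.) -/
noncomputable def pointIdeal (p : Plane K) : Ideal (Coord K) :=
  Ideal.span {g | (∃ n : ℕ, g.IsHomogeneous n) ∧ MvPolynomial.eval p.rep g = 0}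

end

/-- A fat point scheme `m₁ p₁ + ⋯ + m_s p_s` in the plane: finitely many (distinct) points with
non-negative integer multiplicities. -/
abbrev FatPointScheme (K : Type u) [Field K] : Type u := Plane K →₀ ℕ

section

variable {K : Type u} [Field K]

/-- The ideal `I_Z`, the intersection of the ideals `I_p ^ m_p`. -/
noncomputable def FatPointScheme.ideal (Z : FatPointScheme K) : Ideal (Coord K) :=
  ⨅ p ∈ Z.support, pointIdeal p ^ Z p

/-- The space `I_t` of forms of degree `t` in `I`, as a subspace of the space of all forms of
degree `t`. -/
noncomputable def idealForms (I : Ideal (Coord K)) (t : ℕ) :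
    Submodule K (MvPolynomial.homogeneousSubmodule (Fin 3) K t) :=
  (I.restrictScalars K).comap (MvPolynomial.homogeneousSubmodule (Fin 3) K t).subtype

/-- The Hilbert function `t ↦ dim_K (R/I)_t` where `(R/I)_t = R_t / I_t`. -/
noncomputable def hilb (I : Ideal (Coord K)) (t : ℕ) : ℕ :=
  Module.finrank K (MvPolynomial.homogeneousSubmodule (Fin 3) K t ⧸ idealForms I t)

/-- The Hilbert function `h_Z` of a fat point scheme. -/
noncomputable def FatPointScheme.hilb (Z : FatPointScheme K) (t : ℕ) : ℕ :=
  FatPoints.hilb Z.ideal t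

/-- The zero-dimensional (or empty) closed subscheme of the plane defined by the homogeneous
ideal `I` has degree `e`: the Hilbert polynomial of `R/I` is the constant `e`. -/
def HasDegree (I : Ideal (Coord K)) (e : ℕ) : Prop :=
  ∀ᶠ t in Filter.atTop, hilb I t = e

end

/-- A line in the plane, given by a nonzero linear form that defines it. -/
structure Line (K : Type u) [Field K] where
  form : Coord K
  isHomogeneous : form.IsHomogeneous 1
  ne_zero : form ≠ 0

section

variable {K : Type u} [Field K]

/-- The ideal of the `j`-th residual `Z_j` of `Z` with respect to the lines `L 0, L 1, …`:
`I_{Z_0} = I_Z` and `I_{Z_{j+1}} = (I_{Z_j} : F)` with `F` the form of the line `L j`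
(lines are indexed from `0`). The lines `L j` with `r ≤ j` do not exist, and no residual is taken
for them. -/
noncomputable def residualIdeal (Z : FatPointScheme K) {r : ℕ} (L : Fin r → Line K) :
    ℕ → Ideal (Coord K)
  | 0 => Z.ideal
  | j + 1 =>
    if h : j < r then (residualIdeal Z L j).colon {(L ⟨j, h⟩).form} else residualIdeal Z L j

/-- The lines `L` totally reduce `Z`: the last residual scheme is empty. The ideals of the
residuals are saturated, so this means that the last of them is the unit ideal. -/
def TotallyReduces {r : ℕ} (L : Fin r → Line K) (Z : FatPointScheme K) : Prop :=
  residualIdeal Z L r = ⊤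

/-- `d` is the reduction vector of `Z` induced by the lines `L`: its entry `d j` is the degree of
the scheme-theoretic intersection of the line `L j` with `Z_j` (entries indexed from `0`). -/
def IsReductionVector (Z : FatPointScheme K) {r : ℕ} (L : Fin r → Line K) (d : Fin r → ℕ) :
    Prop :=
  ∀ j : Fin r, HasDegree (residualIdeal Z L j ⊔ Ideal.span {(L j).form}) (d j)

/-- `d` is a full reduction vector of `Z`, induced by the totally reducing lines `L`. -/
def IsFullReductionVector (Z : FatPointScheme K) {r : ℕ} (L : Fin r → Line K) (d : Fin r → ℕ) :
    Prop :=
  TotallyReduces L Z ∧ IsReductionVector Z L d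

end

/-- `f_d(t) = ∑_i binom(min(t - i + 1, d_i), 1)`, the sum over `0 ≤ i < r`; the binomial
coefficient is `0` when its upper entry is negative, as is the truncated difference. -/
def lowerBound {r : ℕ} (d : Fin r → ℕ) (t : ℕ) : ℕ :=
  ∑ i : Fin r, min (t + 1 - (i : ℕ)) (d i)

/-- `F_d(t) = min_{0 ≤ i ≤ r} (binom(t + 2, 2) - binom(t - i + 2, 2) + ∑_{i ≤ j < r} d_j)`
(entries indexed from `0`); the second binomial coefficient is `0` when its upper entry is
negative. -/
def upperBound {r : ℕ} (d : Fin r → ℕ) (t : ℕ) : ℕ :=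
  (Finset.range (r + 1)).inf' Finset.nonempty_range_add_one fun i =>
    (t + 2).choose 2 - (t + 2 - i).choose 2 +
      ∑ j ∈ Finset.univ.filter (fun j : Fin r => i ≤ (j : ℕ)), d j

/-- `d` has three consecutive entries of the form `(a, a, a)`. -/
def HasTripleRun {r : ℕ} (d : Fin r → ℕ) : Prop :=
  ∃ (i : ℕ) (h : i + 2 < r),
    d ⟨i, by omega⟩ = d ⟨i + 1, by omega⟩ ∧ d ⟨i + 1, by omega⟩ = d ⟨i + 2, h⟩

/-- The non-increasing vector `d` has consecutive entries `(d_i, …, d_{i+j+1})` with `j > 1`,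
`d_i = d_{i+1}`, `d_{i+j} = d_{i+j+1}`, and `d_{i+1}, …, d_{i+j}` consecutive integers. -/
def HasStairRun {r : ℕ} (d : Fin r → ℕ) : Prop :=
  ∃ (i j : ℕ) (h : i + j + 1 < r) (hj : 1 < j),
    d ⟨i, by omega⟩ = d ⟨i + 1, by omega⟩ ∧
    d ⟨i + j, by omega⟩ = d ⟨i + j + 1, h⟩ ∧
    ∀ (k : ℕ) (_ : i + 1 ≤ k) (hk : k < i + j), d ⟨k, by omega⟩ = d ⟨k + 1, by omega⟩ + 1

section

variable {K : Type u} [Field K]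

/-- The graded free module `⨁_j R[-j]^{ν j}`; the basis vector with index `⟨j, k⟩` has degree
`j`. -/
abbrev GradedFree (K : Type u) [Field K] (ν : ℕ → ℕ) : Type u :=
  (Σ j : ℕ, Fin (ν j)) →₀ Coord K

/-- `ν` and `σ` are the graded Betti numbers of the homogeneous ideal `I`: there is a minimal
graded free resolution `0 → ⨁_j R[-j]^{σ j} → ⨁_j R[-j]^{ν j} → I → 0`, where the maps preserve
degrees and the first one is given by a matrix whose entries are forms of positive degree
(or zero). -/
def HasGradedBetti (I : Ideal (Coord K)) (ν σ : ℕ → ℕ) : Prop :=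
  ∃ (φ₀ : GradedFree K ν →ₗ[Coord K] Coord K)
    (φ₁ : GradedFree K σ →ₗ[Coord K] GradedFree K ν),
    (∀ a, (φ₀ (Finsupp.single a 1)).IsHomogeneous a.1) ∧
    (∀ b a, φ₁ (Finsupp.single b 1) a = 0 ∨
      (a.1 < b.1 ∧ (φ₁ (Finsupp.single b 1) a).IsHomogeneous (b.1 - a.1))) ∧
    LinearMap.range φ₀ = I ∧
    LinearMap.range φ₁ = LinearMap.ker φ₀ ∧
    Function.Injective φ₁

end

end FatPoints

/-!
Let `I` be a homogeneous ideal and `F` a linear form. The exact sequence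
`0 → (R / (I : F))(-1) → R / I → R / (I + F) → 0` adds up Hilbert functions (`hilb_succ`). Applied
to the successive residuals `I_0 = I_Z, I_1, …, I_r = R`, it writes `h_Z(t)` as the sum of the values
at `t - k` of the Hilbert functions of the ideals `I_k + (F_k)` of the line sections
(`hilb_eq_sum`). So everything rests on the possible Hilbert functions of a section.

A section is given by a homogeneous ideal that contains a linear form `F`, and `R / (F)` has
dimension `t + 1` in degree `t`. Once such an ideal contains a form outside `(F)`, its Hilbert
function does not increase any more (`hilb_succ_le_of_notMem`); hence it lies between
`min (t + 1) e` and `t + 1`, where `e` is the degree (`min_le_hilb`, `hilb_le_of_mem`). Summing the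
first estimate gives the lower bound. For the `i`-th term of the upper bound, the sections by the
first `i` lines are estimated by `t + 1 - k`, and the rest by the degree of the `i`-th residual: its
Hilbert function is non-decreasing, because a general linear form is a nonzerodivisor modulo all
the ideals `I_p ^ m`, and therefore modulo all the residuals (`mem_pointIdeal_pow_of_mul_mem`,
`monotone_hilb_residualIdeal`).

The `i`-th term of the upper bound is the sum of `t + 1 - k` for `k < i` and of `d k` for `k ≥ i`,
while the lower bound is the sum of the minima of the two. They agree unless `d k < t + 1 - k` and
`d l > t + 1 - l` for some `k < l`. As `d k + k` grows by at most one at each step, it then takes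
the value `t + 1` on a stretch in between, which shows up in `d` as one of the excluded patterns
(`exists_runs_of_crossing`).

If `d` is strictly decreasing, the bounds agree, and so every section has the least Hilbert function
`min (t + 1) (d k)`. This forces `I_k + (F_k) = (F_k, G_k)` with `G_k ∈ I_k` of degree `d k`
(`le_sup_span_of_hilb_eq`), so `I_k = F_k I_{k+1} + (G_k)`. Since `G_k ∈ I_{k+1}`, a resolution of
`I_{k+1}` extends to one of `I_k` by one generator and one syzygy, and the strict decrease of `d`
makes all entries have positive degree (`HasMinimalResolution.step`). The result is minimal, with
generators of degrees `d k + k` and `r` and syzygies of degrees `d k + k + 1`. Finally, graded Betti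
numbers are unique: `ν` counts the dimensions of `I / 𝔪 I`, and `σ` follows from the dimensions of
the forms in `I` (`HasGradedBetti.unique`).
-/

namespace FatPoints

open MvPolynomial Module

attribute [local instance] MvPolynomial.gradedAlgebra

/-! ### Graded ideals and their Hilbert functions -/

section

variable {K : Type u} [Field K]

/-- The ideal `I` is homogeneous for the standard grading of `K[x₀, x₁, x₂]`. -/
abbrev IsGraded (I : Ideal (Coord K)) : Prop :=
  I.IsHomogeneous (homogeneousSubmodule (Fin 3) K)

/-- The space `I_t` of forms of degree `t` in `I`, as a subspace of the polynomial ring. -/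
noncomputable def forms (I : Ideal (Coord K)) (t : ℕ) : Submodule K (Coord K) :=
  I.restrictScalars K ⊓ homogeneousSubmodule (Fin 3) K t

lemma mem_forms {I : Ideal (Coord K)} {t : ℕ} {f : Coord K} :
    f ∈ forms I t ↔ f ∈ I ∧ f.IsHomogeneous t := Iff.rfl

instance finiteDimensional_homogeneousSubmodule (t : ℕ) :
    FiniteDimensional K (homogeneousSubmodule (Fin 3) K t) :=
  Module.Finite.iff_fg.mpr (homogeneousSubmodule_fg _ _ t)

instance finiteDimensional_forms (I : Ideal (Coord K)) (t : ℕ) :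
    FiniteDimensional K (forms I t) :=
  Submodule.finiteDimensional_of_le (inf_le_right : forms I t ≤ homogeneousSubmodule (Fin 3) K t)

lemma card_degree_eq (t : ℕ) :
    ((Finset.univ : Finset (Fin 3)).finsuppAntidiag t).card = (t + 2).choose 2 := by
  rw [Finset.card_finsuppAntidiag_nat_eq_choose, Finset.card_univ, Fintype.card_fin,
    show 3 + t - 1 = t + 2 by omega, ← Nat.choose_symm_add]

lemma finrank_homogeneousSubmodule (t : ℕ) :
    finrank K (homogeneousSubmodule (Fin 3) K t) = (t + 2).choose 2 := by
  set s := (Finset.univ : Finset (Fin 3)).finsuppAntidiag t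
  have hs : ∀ d : Fin 3 →₀ ℕ, d ∈ s ↔ d.degree = t := fun d => by
    simp [s, Finset.mem_finsuppAntidiag, Finsupp.degree_eq_sum]
  have hli : LinearIndependent K (fun d : s => (monomial (d : Fin 3 →₀ ℕ) (1 : K))) := by
    have := (basisMonomials (Fin 3) K).linearIndependent.comp (fun d : s => (d : Fin 3 →₀ ℕ))
      Subtype.val_injective
    simpa [Function.comp_def] using this
  have hspan : Submodule.span K (Set.range fun d : s => (monomial (d : Fin 3 →₀ ℕ) (1 : K))) =
      homogeneousSubmodule (Fin 3) K t := by
    apply le_antisymm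
    · rw [Submodule.span_le]
      rintro _ ⟨d, rfl⟩
      exact isHomogeneous_monomial _ ((hs d).1 d.2)
    · intro f hf
      rw [f.as_sum]
      refine Submodule.sum_mem _ fun d hd => ?_
      have hd' : d.degree = t := by
        by_contra h
        exact (mem_support_iff.1 hd) (IsHomogeneous.coeff_eq_zero hf h)
      have : monomial d (coeff d f) = coeff d f • monomial d (1 : K) := by
        rw [smul_monomial, smul_eq_mul, mul_one]
      rw [this]
      exact Submodule.smul_mem _ _ (Submodule.subset_span ⟨⟨d, (hs d).2 hd'⟩, rfl⟩)
  rw [← hspan, finrank_span_eq_card hli, Fintype.card_coe, card_degree_eq]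

lemma hilb_add_finrank_forms (I : Ideal (Coord K)) (t : ℕ) :
    hilb I t + finrank K (forms I t) = (t + 2).choose 2 := by
  have h1 := Submodule.finrank_quotient_add_finrank (idealForms I t)
  have h2 : finrank K (idealForms I t) = finrank K (forms I t) := by
    have e : (idealForms I t).map (homogeneousSubmodule (Fin 3) K t).subtype = forms I t := by
      simp only [idealForms, forms, Submodule.map_comap_subtype, inf_comm]
    rw [← e, Submodule.finrank_map_subtype_eq]
  rw [finrank_homogeneousSubmodule] at h1
  rw [← h2]
  exact h1

lemma forms_mono {I J : Ideal (Coord K)} (h : I ≤ J) (t : ℕ) : forms I t ≤ forms J t :=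
  fun _ hf => ⟨h hf.1, hf.2⟩

lemma hilb_anti {I J : Ideal (Coord K)} (h : I ≤ J) (t : ℕ) : hilb J t ≤ hilb I t := by
  have h1 := hilb_add_finrank_forms I t
  have h2 := hilb_add_finrank_forms J t
  have := Submodule.finrank_mono (forms_mono h t)
  omega

lemma hilb_lt {I J : Ideal (Coord K)} (h : I ≤ J) {t : ℕ} {f : Coord K} (hf : f ∈ forms J t)
    (hfI : f ∉ I) : hilb J t < hilb I t := by
  have h1 := hilb_add_finrank_forms I t
  have h2 := hilb_add_finrank_forms J t
  have : finrank K (forms I t) < finrank K (forms J t) :=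
    Submodule.finrank_lt_finrank_of_lt (lt_of_le_of_ne (forms_mono h t) fun e => by
      rw [← e] at hf
      exact hfI hf.1)
  omega

lemma forms_eq_of_hilb_le {I J : Ideal (Coord K)} (h : I ≤ J) {t : ℕ} (ht : hilb I t ≤ hilb J t) :
    forms I t = forms J t := by
  have h1 := hilb_add_finrank_forms I t
  have h2 := hilb_add_finrank_forms J t
  exact Submodule.eq_of_le_of_finrank_le (forms_mono h t) (by omega)

lemma hilb_bot (t : ℕ) : hilb (⊥ : Ideal (Coord K)) t = (t + 2).choose 2 := by
  have h1 := hilb_add_finrank_forms (⊥ : Ideal (Coord K)) t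
  have : forms (⊥ : Ideal (Coord K)) t = ⊥ := by
    ext f
    rw [mem_forms, Submodule.mem_bot, Submodule.mem_bot]
    exact ⟨fun h => h.1, fun h => ⟨h, h ▸ isHomogeneous_zero _ _ _⟩⟩
  rw [this, finrank_bot] at h1
  omega

lemma hilb_top (t : ℕ) : hilb (⊤ : Ideal (Coord K)) t = 0 := by
  have h1 := hilb_add_finrank_forms (⊤ : Ideal (Coord K)) t
  have : forms (⊤ : Ideal (Coord K)) t = homogeneousSubmodule (Fin 3) K t := by
    ext f
    rw [mem_forms, mem_homogeneousSubmodule]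
    simp
  rw [this, finrank_homogeneousSubmodule] at h1
  omega

lemma homogeneousComponent_mul_of_isHomogeneous {q : Coord K} {n : ℕ} (hq : q.IsHomogeneous n)
    (p : Coord K) (m : ℕ) :
    homogeneousComponent m (p * q) =
      if n ≤ m then homogeneousComponent (m - n) p * q else 0 := by
  have h := DirectSum.coe_decompose_mul_of_right_mem (homogeneousSubmodule (Fin 3) K) (a := p)
    m hq
  have key : ∀ (f : Coord K) (i : ℕ),
      ((DirectSum.decompose (homogeneousSubmodule (Fin 3) K) f) i : Coord K) =
        homogeneousComponent i f :=
    fun f i => decomposition.decompose'_apply f i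
  simpa only [key] using h

lemma IsGraded.component_mem {I : Ideal (Coord K)} (h : IsGraded I) {f : Coord K} (hf : f ∈ I)
    (n : ℕ) : homogeneousComponent n f ∈ I :=
  homogeneousComponent_mem_of_mem h hf n

lemma isGraded_of_component_mem {I : Ideal (Coord K)}
    (h : ∀ f ∈ I, ∀ n, homogeneousComponent n f ∈ I) : IsGraded I := by
  intro n f hf
  have : ((DirectSum.decompose (homogeneousSubmodule (Fin 3) K) f) n : Coord K) =
        homogeneousComponent n f := decomposition.decompose'_apply f n
  rw [this]
  exact h f hf n

lemma isGraded_span {s : Set (Coord K)} (h : ∀ f ∈ s, ∃ n, f.IsHomogeneous n) :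
    IsGraded (Ideal.span s) :=
  Ideal.homogeneous_span _ _ fun f hf => h f hf

lemma isGraded_span_singleton {F : Coord K} {n : ℕ} (hF : F.IsHomogeneous n) :
    IsGraded (Ideal.span {F}) :=
  isGraded_span fun f hf => ⟨n, by rwa [Set.mem_singleton_iff.1 hf]⟩

lemma isGraded_pow {I : Ideal (Coord K)} (h : IsGraded I) (n : ℕ) : IsGraded (I ^ n) := by
  induction n with
  | zero => rw [pow_zero, Ideal.one_eq_top]; exact Ideal.IsHomogeneous.top _
  | succ n ih => rw [pow_succ]; exact Ideal.IsHomogeneous.mul ih h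

lemma mem_colon_iff {I : Ideal (Coord K)} {F f : Coord K} :
    f ∈ I.colon {F} ↔ f * F ∈ I := by
  rw [Submodule.mem_colon_singleton, smul_eq_mul]

lemma IsGraded.colon {I : Ideal (Coord K)} (h : IsGraded I) {F : Coord K} {n : ℕ}
    (hF : F.IsHomogeneous n) : IsGraded (I.colon {F}) := by
  refine isGraded_of_component_mem fun f hf m => ?_
  rw [mem_colon_iff] at hf ⊢
  have := h.component_mem hf (m + n)
  rwa [homogeneousComponent_mul_of_isHomogeneous hF, if_pos (Nat.le_add_left n m),
    Nat.add_sub_cancel] at this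

/-- A graded ideal is determined by its forms. -/
lemma IsGraded.le_of_forms_le {I J : Ideal (Coord K)} (h : IsGraded I)
    (hle : ∀ t, forms I t ≤ forms J t) : I ≤ J := by
  intro f hf
  rw [← sum_homogeneousComponent f]
  exact J.sum_mem fun i _ => (hle i ⟨h.component_mem hf i, homogeneousComponent_isHomogeneous i f⟩).1

/-- Additivity of Hilbert functions along the exact sequence
`0 → (R / (I : F))(-1) → R / I → R / (I + F) → 0`. -/
lemma hilb_succ {I : Ideal (Coord K)} (h : IsGraded I) {F : Coord K} (hF : F.IsHomogeneous 1)
    (hF0 : F ≠ 0) (t : ℕ) :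
    hilb I (t + 1) = hilb (I.colon {F}) t + hilb (I ⊔ Ideal.span {F}) (t + 1) := by
  let m : Coord K →ₗ[K] Coord K := LinearMap.mulRight K F
  have hm : Function.Injective m := fun a b hab => mul_right_cancel₀ hF0 hab
  have hdim : ∀ V : Submodule K (Coord K), finrank K (V.map m) = finrank K V := fun V =>
    (LinearEquiv.finrank_eq (V.equivMapOfInjective m hm)).symm
  have hsup : forms (I ⊔ Ideal.span {F}) (t + 1) =
      forms I (t + 1) ⊔ (homogeneousSubmodule (Fin 3) K t).map m := by
    apply le_antisymm
    · rintro f ⟨hf, hft⟩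
      obtain ⟨a, ha, b, hb, rfl⟩ := Submodule.mem_sup.1 (show f ∈ I ⊔ Ideal.span {F} from hf)
      obtain ⟨c, rfl⟩ := Ideal.mem_span_singleton'.1 hb
      rw [← homogeneousComponent_eq_self hft, map_add,
        homogeneousComponent_mul_of_isHomogeneous hF, if_pos (Nat.le_add_left 1 t),
        Nat.add_sub_cancel]
      exact Submodule.add_mem_sup
        ⟨h.component_mem ha _, homogeneousComponent_isHomogeneous _ _⟩
        ⟨_, homogeneousComponent_isHomogeneous _ _, rfl⟩
    · refine sup_le (forms_mono le_sup_left _) ?_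
      rintro _ ⟨g, hg, rfl⟩
      exact ⟨Ideal.mem_sup_right (Ideal.mem_span_singleton'.2 ⟨g, rfl⟩), IsHomogeneous.mul hg hF⟩
  have hinf : forms I (t + 1) ⊓ (homogeneousSubmodule (Fin 3) K t).map m =
      (forms (I.colon {F}) t).map m := by
    apply le_antisymm
    · rintro _ ⟨hf, ⟨g, hg, rfl⟩⟩
      exact ⟨g, ⟨mem_colon_iff.2 hf.1, hg⟩, rfl⟩
    · rintro _ ⟨g, hg, rfl⟩
      exact ⟨⟨mem_colon_iff.1 hg.1, IsHomogeneous.mul hg.2 hF⟩, ⟨g, hg.2, rfl⟩⟩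
  have key := Submodule.finrank_sup_add_finrank_inf_eq (forms I (t + 1))
    ((homogeneousSubmodule (Fin 3) K t).map m)
  rw [← hsup, hinf, hdim, hdim, finrank_homogeneousSubmodule] at key
  have h1 := hilb_add_finrank_forms I (t + 1)
  have h2 := hilb_add_finrank_forms (I.colon {F}) t
  have h3 := hilb_add_finrank_forms (I ⊔ Ideal.span {F}) (t + 1)
  omega

lemma hilb_zero {I : Ideal (Coord K)} (h : IsGraded I) {F : Coord K} (hF : F.IsHomogeneous 1) :
    hilb I 0 = hilb (I ⊔ Ideal.span {F}) 0 := by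
  refine le_antisymm ?_ (hilb_anti le_sup_left _)
  have hle : forms (I ⊔ Ideal.span {F}) 0 ≤ forms I 0 := by
    rintro f ⟨hf, hft⟩
    obtain ⟨a, ha, b, hb, rfl⟩ := Submodule.mem_sup.1 (show f ∈ I ⊔ Ideal.span {F} from hf)
    obtain ⟨c, rfl⟩ := Ideal.mem_span_singleton'.1 hb
    rw [← homogeneousComponent_eq_self hft, map_add,
      homogeneousComponent_mul_of_isHomogeneous hF, if_neg (by omega), add_zero]
    exact ⟨h.component_mem ha _, homogeneousComponent_isHomogeneous _ _⟩
  have h1 := hilb_add_finrank_forms I 0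
  have h2 := hilb_add_finrank_forms (I ⊔ Ideal.span {F}) 0
  have := Submodule.finrank_mono hle
  omega

lemma choose_two_succ (t : ℕ) : (t + 1 + 2).choose 2 = (t + 2).choose 2 + (t + 2) := by
  rw [show t + 1 + 2 = (t + 2) + 1 by ring, Nat.choose_succ_succ' (t + 2) 1, Nat.choose_one_right]
  ring

lemma hilb_span_singleton {F : Coord K} (hF : F.IsHomogeneous 1) (hF0 : F ≠ 0) (t : ℕ) :
    hilb (Ideal.span {F}) t = t + 1 := by
  have hb : IsGraded (⊥ : Ideal (Coord K)) := Ideal.IsHomogeneous.bot _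
  cases t with
  | zero => simpa [hilb_bot] using (hilb_zero hb hF).symm
  | succ t =>
    have h := hilb_succ hb hF hF0 t
    have hc : (⊥ : Ideal (Coord K)).colon {F} = ⊥ := by
      ext f
      rw [mem_colon_iff, Submodule.mem_bot, Submodule.mem_bot, mul_eq_zero, or_iff_left hF0]
    rw [hc, hilb_bot, hilb_bot, bot_sup_eq, choose_two_succ] at h
    omega

/-- The Hilbert function of `R / I` does not decrease if some linear form is a nonzerodivisor
modulo `I`. -/
lemma hilb_le_succ {I : Ideal (Coord K)} (h : IsGraded I) {F : Coord K} (hF : F.IsHomogeneous 1)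
    (hF0 : F ≠ 0) (hc : I.colon {F} = I) (t : ℕ) : hilb I t ≤ hilb I (t + 1) := by
  rw [hilb_succ h hF hF0, hc]
  exact Nat.le_add_right _ _

end

/-! ### Linear forms and the projection along a point off a line -/

section

variable {K : Type u} [Field K]

lemma exists_eq_sum_of_isHomogeneous_one {F : Coord K} (hF : F.IsHomogeneous 1) :
    ∃ a : Fin 3 → K, F = ∑ i, C (a i) * X i := by
  have h : F ∈ homogeneousSubmodule (Fin 3) K 1 := hF
  rw [homogeneousSubmodule_one_eq_span_X, Submodule.mem_span_range_iff_exists_fun] at h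
  obtain ⟨a, ha⟩ := h
  exact ⟨a, by simp only [← ha, smul_eq_C_mul]⟩

lemma isHomogeneous_sum_C_mul_X (a : Fin 3 → K) :
    (∑ i, C (a i) * X i : Coord K).IsHomogeneous 1 :=
  IsHomogeneous.sum _ _ _ fun _ _ => isHomogeneous_C_mul_X _ _

/-- The substitution `x ↦ x - F(x) c`. If `F` is a linear form with `F(c) = 1`, it is the
projection from the point `c` onto the line `F = 0`. -/
noncomputable def proj (F : Coord K) (c : Fin 3 → K) : Coord K →ₐ[K] Coord K :=
  aeval fun i => X i - C (c i) * F

lemma proj_X (F : Coord K) (c : Fin 3 → K) (i : Fin 3) : proj F c (X i) = X i - C (c i) * F :=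
  aeval_X _ _

lemma proj_self {F : Coord K} (hF : F.IsHomogeneous 1) {c : Fin 3 → K} (hc : eval c F = 1) :
    proj F c F = 0 := by
  obtain ⟨a, ha⟩ := exists_eq_sum_of_isHomogeneous_one hF
  have h1 : proj F c F = F - C (eval c F) * F := by
    conv_lhs => rw [show proj F c F = proj F c (∑ i, C (a i) * X i) by rw [← ha]]
    conv_rhs => rw [show eval c F = ∑ i, a i * c i by rw [ha]; simp]
    rw [map_sum]
    simp only [map_mul, proj_X, algHom_C, algebraMap_eq, map_sum, mul_sub, Finset.sum_sub_distrib,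
      Finset.sum_mul, mul_assoc]
    rw [← ha]
  rw [h1, hc, C_1, one_mul, sub_self]

lemma sub_mem_of_forall_X {A : Type*} [CommRing A] [Algebra K A] {φ ψ : Coord K →ₐ[K] A}
    {J : Ideal A} (h : ∀ i, φ (X i) - ψ (X i) ∈ J) (g : Coord K) : φ g - ψ g ∈ J := by
  rw [← Ideal.Quotient.eq]
  have : (Ideal.Quotient.mkₐ K J).comp φ = (Ideal.Quotient.mkₐ K J).comp ψ := by
    ext i
    exact Ideal.Quotient.eq.2 (h i)
  exact DFunLike.congr_fun this g

lemma sub_proj_mem (F : Coord K) (c : Fin 3 → K) (g : Coord K) :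
    g - proj F c g ∈ Ideal.span {F} := by
  refine sub_mem_of_forall_X (φ := AlgHom.id K (Coord K)) (fun i => ?_) g
  rw [AlgHom.id_apply, proj_X, sub_sub_cancel]
  exact Ideal.mul_mem_left _ _ (Ideal.mem_span_singleton_self F)

lemma mem_span_iff_proj_eq_zero {F : Coord K} (hF : F.IsHomogeneous 1) {c : Fin 3 → K}
    (hc : eval c F = 1) (g : Coord K) : g ∈ Ideal.span {F} ↔ proj F c g = 0 := by
  constructor
  · intro h
    obtain ⟨b, rfl⟩ := Ideal.mem_span_singleton'.1 h
    rw [map_mul, proj_self hF hc, mul_zero]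
  · intro h
    simpa [h] using sub_proj_mem F c g

lemma eval_proj (F : Coord K) (c q : Fin 3 → K) (g : Coord K) :
    eval q (proj F c g) = eval (fun i => q i - c i * eval q F) g := by
  have : (aeval q : Coord K →ₐ[K] K).comp (proj F c) = aeval fun i => q i - c i * eval q F := by
    ext i
    simp [proj_X, aeval_eq_eval]
  have h := DFunLike.congr_fun this g
  simpa [aeval_eq_eval] using h

lemma aeval_mul_of_isHomogeneous {A : Type*} [CommRing A] [Algebra K A] {g : Coord K} {n : ℕ}
    (hg : g.IsHomogeneous n) (c : Fin 3 → K) (s : A) :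
    aeval (fun i => algebraMap K A (c i) * s) g = algebraMap K A (eval c g) * s ^ n := by
  rw [aeval_def, eval₂_eq', eval_eq', map_sum, Finset.sum_mul]
  refine Finset.sum_congr rfl fun d hd => ?_
  have hdn : ∑ i, d i = n := by
    rw [← Finsupp.degree_eq_sum]
    by_contra h
    exact (mem_support_iff.1 hd) (hg.coeff_eq_zero h)
  rw [map_mul, map_prod, mul_assoc, ← hdn, ← Finset.prod_pow_eq_pow_sum, ← Finset.prod_mul_distrib]
  simp only [mul_pow, map_pow]

lemma eval_mul_of_isHomogeneous {g : Coord K} {n : ℕ} (hg : g.IsHomogeneous n)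
    (c : Fin 3 → K) (s : K) : eval (fun i => c i * s) g = eval c g * s ^ n := by
  simpa [aeval_eq_eval] using aeval_mul_of_isHomogeneous (A := K) hg c s

lemma exists_eval_eq_one [Infinite K] {F : Coord K} (hF : F.IsHomogeneous 1) (hF0 : F ≠ 0) :
    ∃ c : Fin 3 → K, eval c F = 1 := by
  obtain ⟨c, hc⟩ : ∃ c : Fin 3 → K, eval c F ≠ 0 := by
    by_contra! h
    exact hF0 (MvPolynomial.funext fun x => by rw [h x, map_zero])
  refine ⟨fun i => c i * (eval c F)⁻¹, ?_⟩
  rw [eval_mul_of_isHomogeneous hF, pow_one, mul_inv_cancel₀ hc]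

lemma isPrime_span_singleton [Infinite K] {F : Coord K} (hF : F.IsHomogeneous 1) (hF0 : F ≠ 0) :
    (Ideal.span {F}).IsPrime := by
  obtain ⟨c, hc⟩ := exists_eval_eq_one hF hF0
  have : Ideal.span {F} = RingHom.ker (proj F c) := by
    ext g
    rw [mem_span_iff_proj_eq_zero hF hc, RingHom.mem_ker]
  rw [this]
  exact RingHom.ker_isPrime _

lemma exists_eval_ne_zero_of_notMem [Infinite K] {F : Coord K} (hF : F.IsHomogeneous 1)
    (hF0 : F ≠ 0) {g : Coord K} (hg : g ∉ Ideal.span {F}) :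
    ∃ q : Fin 3 → K, eval q F = 0 ∧ eval q g ≠ 0 := by
  obtain ⟨c, hc⟩ := exists_eval_eq_one hF hF0
  rw [mem_span_iff_proj_eq_zero hF hc] at hg
  obtain ⟨q, hq⟩ : ∃ q : Fin 3 → K, eval q (proj F c g) ≠ 0 := by
    by_contra! h
    exact hg (MvPolynomial.funext fun x => by rw [h x, map_zero])
  refine ⟨fun i => q i - c i * eval q F, ?_, by rwa [← eval_proj]⟩
  rw [← eval_proj, proj_self hF hc, map_zero]

lemma exists_linear_notMem {F : Coord K} (hF : F.IsHomogeneous 1) (hF0 : F ≠ 0) :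
    ∃ l : Coord K, l.IsHomogeneous 1 ∧ l ∉ Ideal.span {F} := by
  by_contra! h
  have h1 := hilb_add_finrank_forms (Ideal.span {F}) 1
  have h2 : forms (Ideal.span {F}) 1 = homogeneousSubmodule (Fin 3) K 1 :=
    le_antisymm inf_le_right fun l hl => ⟨h l hl, hl⟩
  rw [hilb_span_singleton hF hF0, h2, finrank_homogeneousSubmodule] at h1
  omega

lemma exists_linear_notMem_eval_eq_zero {F : Coord K} (hF : F.IsHomogeneous 1) (hF0 : F ≠ 0)
    (q : Fin 3 → K) :
    ∃ l : Coord K, l.IsHomogeneous 1 ∧ eval q l = 0 ∧ l ∉ Ideal.span {F} := by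
  by_contra! h
  have h1 := hilb_add_finrank_forms (Ideal.span {F}) 1
  let e : homogeneousSubmodule (Fin 3) K 1 →ₗ[K] K :=
    (aeval q : Coord K →ₐ[K] K).toLinearMap.domRestrict _
  have h2 := e.finrank_range_add_finrank_ker
  have h3 : finrank K e.range ≤ 1 := (Submodule.finrank_le _).trans (finrank_self K).le
  have h4 : (e.ker).map (homogeneousSubmodule (Fin 3) K 1).subtype ≤ forms (Ideal.span {F}) 1 := by
    rintro _ ⟨l, hl, rfl⟩
    exact ⟨h _ l.2 hl, l.2⟩
  have h5 := Submodule.finrank_mono h4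
  rw [Submodule.finrank_map_subtype_eq] at h5
  rw [hilb_span_singleton hF hF0, show Nat.choose (1 + 2) 2 = 3 from rfl] at h1
  rw [finrank_homogeneousSubmodule, show Nat.choose (1 + 2) 2 = 3 from rfl] at h2
  have h6 : finrank K (forms (Ideal.span {F}) 1) = 1 := by linarith
  have h7 : 2 ≤ finrank K e.ker := by linarith
  linarith

end

/-! ### Hilbert functions of subschemes of a line -/

section

variable {K : Type u} [Field K]

/-- On the line `F = 0`, once an ideal contains a nonzero form, its Hilbert function does not
increase any more. -/
lemma hilb_succ_le_of_notMem [Infinite K] {F : Coord K} (hF : F.IsHomogeneous 1) (hF0 : F ≠ 0)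
    {J : Ideal (Coord K)} (hJ : IsGraded J) (hFJ : F ∈ J) {t : ℕ} {g : Coord K}
    (hg : g ∈ forms J t) (hgF : g ∉ Ideal.span {F}) :
    hilb J (t + 1) ≤ hilb J t ∧ ∃ g' ∈ forms J (t + 1), g' ∉ Ideal.span {F} := by
  have hprime := isPrime_span_singleton hF hF0
  obtain ⟨l', hl', hl'F⟩ := exists_linear_notMem hF hF0
  have hg'J : g * l' ∈ forms J (t + 1) := ⟨J.mul_mem_right _ hg.1, IsHomogeneous.mul hg.2 hl'⟩
  have hg'F : g * l' ∉ Ideal.span {F} := fun h => (hprime.mem_or_mem h).elim hgF hl'F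
  refine ⟨?_, g * l', hg'J, hg'F⟩
  -- A point `q` of the line off `g l' = 0`, and a second line `l` through `q`: modulo `F` and `l`
  -- the forms of each degree are one-dimensional, and `g l'` spans those of degree `t + 1`.
  obtain ⟨q, hqF, hqg⟩ := exists_eval_ne_zero_of_notMem hF hF0 hg'F
  obtain ⟨l, hl, hql, hlF⟩ := exists_linear_notMem_eval_eq_zero hF hF0 q
  have hl0 : l ≠ 0 := fun h => hlF (h ▸ Ideal.zero_mem _)
  have hcolon : (Ideal.span {F}).colon {l} = Ideal.span {F} := by
    ext f
    rw [mem_colon_iff]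
    exact ⟨fun h => (hprime.mem_or_mem h).resolve_right hlF, fun h => Ideal.mul_mem_right _ _ h⟩
  have h1 := hilb_succ (isGraded_span_singleton hF) hl hl0 t
  rw [hcolon, hilb_span_singleton hF hF0, hilb_span_singleton hF hF0] at h1
  have hle : Ideal.span {F} ⊔ Ideal.span {l} ≤ RingHom.ker (eval q) := by
    rw [sup_le_iff, Ideal.span_singleton_le_iff_mem, Ideal.span_singleton_le_iff_mem]
    exact ⟨hqF, hql⟩
  have h2 : hilb (J ⊔ Ideal.span {l}) (t + 1) < hilb (Ideal.span {F} ⊔ Ideal.span {l}) (t + 1) :=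
    hilb_lt (sup_le_sup_right ((Ideal.span_singleton_le_iff_mem _).2 hFJ) _)
      (forms_mono le_sup_left _ hg'J) fun h => hqg (hle h)
  have h3 := hilb_succ hJ hl hl0 t
  have h4 : hilb (J.colon {l}) t ≤ hilb J t :=
    hilb_anti (fun f hf => mem_colon_iff.2 (J.mul_mem_right _ hf)) t
  omega

lemma hilb_le_of_notMem [Infinite K] {F : Coord K} (hF : F.IsHomogeneous 1) (hF0 : F ≠ 0)
    {J : Ideal (Coord K)} (hJ : IsGraded J) (hFJ : F ∈ J) {t : ℕ} {g : Coord K}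
    (hg : g ∈ forms J t) (hgF : g ∉ Ideal.span {F}) (n : ℕ) :
    hilb J (t + n) ≤ hilb J t := by
  have key : hilb J (t + n) ≤ hilb J t ∧ ∃ g' ∈ forms J (t + n), g' ∉ Ideal.span {F} := by
    induction n with
    | zero => exact ⟨le_rfl, g, hg, hgF⟩
    | succ n ih =>
      obtain ⟨h1, g', hg', hg'F⟩ := ih
      obtain ⟨h2, h3⟩ := hilb_succ_le_of_notMem hF hF0 hJ hFJ hg' hg'F
      exact ⟨h2.trans h1, h3⟩
  exact key.1

lemma hilb_le_of_mem {F : Coord K} (hF : F.IsHomogeneous 1) (hF0 : F ≠ 0)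
    {J : Ideal (Coord K)} (hFJ : F ∈ J) (t : ℕ) : hilb J t ≤ t + 1 :=
  (hilb_anti ((Ideal.span_singleton_le_iff_mem _).2 hFJ) t).trans
    (hilb_span_singleton hF hF0 t).le

/-- A subscheme of degree `e` of a line imposes at least `min (t + 1) e` conditions on forms of
degree `t`. -/
lemma min_le_hilb [Infinite K] {F : Coord K} (hF : F.IsHomogeneous 1) (hF0 : F ≠ 0)
    {J : Ideal (Coord K)} (hJ : IsGraded J) (hFJ : F ∈ J) {e : ℕ} (he : HasDegree J e) (t : ℕ) :
    min (t + 1) e ≤ hilb J t := by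
  by_cases h : forms J t ≤ forms (Ideal.span {F}) t
  · have h1 := hilb_add_finrank_forms J t
    have h2 := hilb_add_finrank_forms (Ideal.span {F}) t
    have h3 := Submodule.finrank_mono h
    rw [hilb_span_singleton hF hF0] at h2
    omega
  · obtain ⟨g, hg, hgF⟩ := Set.not_subset.1 h
    have hgF' : g ∉ Ideal.span {F} := fun h' => hgF ⟨h', hg.2⟩
    obtain ⟨N, hN⟩ := Filter.eventually_atTop.1 he
    have h1 := hilb_le_of_notMem hF hF0 hJ hFJ hg hgF' N
    rw [hN _ (Nat.le_add_left N t)] at h1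
    exact (min_le_right _ _).trans h1

/-- If a subscheme of degree `e` of a line has the least Hilbert function possible, then its ideal
is generated by the equation of the line and one form of degree `e`. -/
lemma le_sup_span_of_hilb_eq [Infinite K] {F : Coord K} (hF : F.IsHomogeneous 1) (hF0 : F ≠ 0)
    {I : Ideal (Coord K)} (hI : IsGraded I) {e : ℕ}
    (he : ∀ t, hilb (I ⊔ Ideal.span {F}) t = min (t + 1) e) :
    ∃ G ∈ I, G.IsHomogeneous e ∧ G ∉ Ideal.span {F} ∧ I ≤ Ideal.span {F} ⊔ Ideal.span {G} := by
  have hJ : IsGraded (I ⊔ Ideal.span {F}) := hI.sup (isGraded_span_singleton hF)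
  obtain ⟨G', hG', hG'F⟩ : ∃ G' ∈ forms (I ⊔ Ideal.span {F}) e, G' ∉ Ideal.span {F} := by
    by_contra! h
    have h1 : hilb (Ideal.span {F}) e ≤ hilb (I ⊔ Ideal.span {F}) e := by
      have h1 := hilb_add_finrank_forms (I ⊔ Ideal.span {F}) e
      have h2 := hilb_add_finrank_forms (Ideal.span {F}) e
      have h3 : forms (I ⊔ Ideal.span {F}) e ≤ forms (Ideal.span {F}) e :=
        fun f hf => ⟨h f hf, hf.2⟩
      have := Submodule.finrank_mono h3
      omega
    rw [he, hilb_span_singleton hF hF0] at h1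
    omega
  obtain ⟨a, ha, b, hb, hab⟩ := Submodule.mem_sup.1 (show G' ∈ I ⊔ Ideal.span {F} from hG'.1)
  have hG : homogeneousComponent e a ∈ I := hI.component_mem ha e
  have hGF : homogeneousComponent e a ∉ Ideal.span {F} := by
    intro h
    apply hG'F
    rw [← homogeneousComponent_eq_self hG'.2, ← hab, map_add]
    exact Ideal.add_mem _ h ((isGraded_span_singleton hF).component_mem hb e)
  have hGe := homogeneousComponent_isHomogeneous e a
  generalize homogeneousComponent e a = G at hG hGF hGe
  refine ⟨G, hG, hGe, hGF, le_trans (le_sup_left : I ≤ I ⊔ Ideal.span {F}) ?_⟩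
  refine IsGraded.le_of_forms_le hJ fun t => ?_
  have hFG : Ideal.span {F} ⊔ Ideal.span {G} ≤ I ⊔ Ideal.span {F} :=
    sup_le le_sup_right (((Ideal.span_singleton_le_iff_mem _).2 hG).trans le_sup_left)
  have hFGg : IsGraded (Ideal.span {F} ⊔ Ideal.span {G}) :=
    (isGraded_span_singleton hF).sup (isGraded_span_singleton hGe)
  refine (forms_eq_of_hilb_le hFG ?_).ge
  rw [he]
  refine le_min (hilb_le_of_mem hF hF0 (Ideal.mem_sup_left (Ideal.mem_span_singleton_self F)) t) ?_
  have hGm : G ∈ Ideal.span {F} ⊔ Ideal.span {G} :=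
    Ideal.mem_sup_right (Ideal.mem_span_singleton_self G)
  have hlt : hilb (Ideal.span {F} ⊔ Ideal.span {G}) e < hilb (Ideal.span {F}) e :=
    hilb_lt le_sup_left ⟨hGm, hGe⟩ hGF
  rw [hilb_span_singleton hF hF0] at hlt
  rcases le_or_gt e t with het | het
  · obtain ⟨n, rfl⟩ := Nat.exists_eq_add_of_le het
    have := hilb_le_of_notMem hF hF0 hFGg (Ideal.mem_sup_left (Ideal.mem_span_singleton_self F))
      ⟨hGm, hGe⟩ hGF n
    omega
  · have := hilb_le_of_mem hF hF0 (J := Ideal.span {F} ⊔ Ideal.span {G})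
      (Ideal.mem_sup_left (Ideal.mem_span_singleton_self F)) t
    omega

end

/-! ### Saturation of the ideals of fat points -/

section

variable {K : Type u} [Field K]

/-- For a linear form `l` with `l(c) = 1`, the expansion `x ↦ (x - l(x) c) + T c` along the
direction `c`; it sends `l` to the variable `T`, and the substitution `T = l` is a left inverse. -/
noncomputable def expand (l : Coord K) (c : Fin 3 → K) : Coord K →ₐ[K] Polynomial (Coord K) :=
  aeval fun i => Polynomial.C (proj l c (X i)) + Polynomial.C (C (c i)) * Polynomial.X

lemma expand_X (l : Coord K) (c : Fin 3 → K) (i : Fin 3) :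
    expand l c (X i) = Polynomial.C (proj l c (X i)) + Polynomial.C (C (c i)) * Polynomial.X :=
  aeval_X _ _

lemma expand_self {l : Coord K} (hl : l.IsHomogeneous 1) {c : Fin 3 → K} (hc : eval c l = 1) :
    expand l c l = Polynomial.X := by
  have hp := proj_self hl hc
  obtain ⟨a, ha⟩ := exists_eq_sum_of_isHomogeneous_one hl
  have hca : ∑ i, a i * c i = 1 := by
    rw [← hc, ha]
    simp
  have h1 : ∑ i, C (a i) * proj l c (X i) = 0 := by
    conv_rhs => rw [← hp]
    conv_rhs => rw [show proj l c l = proj l c (∑ i, C (a i) * X i) by rw [← ha]]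
    simp only [map_sum, map_mul, algHom_C, algebraMap_eq]
  have h2 : ∀ k : K, expand l c (C k) = Polynomial.C (C k) := fun k => (expand l c).commutes k
  conv_lhs => rw [show expand l c l = expand l c (∑ i, C (a i) * X i) by rw [← ha]]
  simp only [map_sum, map_mul, h2, expand_X, mul_add, Finset.sum_add_distrib, ← mul_assoc,
    ← Finset.sum_mul]
  simp only [← Polynomial.C_mul, ← C_mul, ← map_sum, h1, hca]
  simp

lemma eval_expand (l : Coord K) (c : Fin 3 → K) (g : Coord K) :
    (expand l c g).eval l = g := by
  have : ((Polynomial.aeval l : Polynomial (Coord K) →ₐ[Coord K] Coord K).restrictScalars K).comp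
      (expand l c) = AlgHom.id K (Coord K) := by
    ext i
    simp [expand_X, proj_X]
  have h := DFunLike.congr_fun this g
  simpa [Polynomial.coe_aeval_eq_eval] using h

lemma expand_mem_map_C {l : Coord K} {c : Fin 3 → K} {g : Coord K} {n : ℕ}
    (hg : g.IsHomogeneous n) (hgc : eval c g = 0) :
    expand l c g ∈
      (Ideal.span (Set.range fun i => proj l c (X i))).map (Polynomial.C : Coord K →+* _) := by
  have h := sub_mem_of_forall_X (φ := expand l c)
    (ψ := aeval fun i => algebraMap K (Polynomial (Coord K)) (c i) * Polynomial.X)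
    (J := (Ideal.span (Set.range fun i => proj l c (X i))).map (Polynomial.C : Coord K →+* _))
    (fun i => ?_) g
  · rwa [aeval_mul_of_isHomogeneous hg, hgc, map_zero, zero_mul, sub_zero] at h
  · rw [expand_X, aeval_X]
    convert Ideal.mem_map_of_mem (Polynomial.C : Coord K →+* _)
      (Ideal.subset_span (Set.mem_range_self (f := fun i => proj l c (X i)) i)) using 1
    rw [add_sub_assoc]
    exact add_eq_left.2 (sub_self _)

/-- A linear form `l` that does not vanish at `p` is a nonzerodivisor modulo each power of the ideal
of `p`: under the expansion along `p`, this ideal is extended from an ideal of coefficients, and `l`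
becomes the variable `T`. -/
lemma mem_pointIdeal_pow_of_mul_mem (p : Plane K) (m : ℕ) {l : Coord K} (hl : l.IsHomogeneous 1)
    (hlp : eval p.rep l ≠ 0) {g : Coord K} (hg : g * l ∈ pointIdeal p ^ m) :
    g ∈ pointIdeal p ^ m := by
  set u := (eval p.rep l)⁻¹
  set c : Fin 3 → K := fun i => p.rep i * u with hcdef
  have hc : eval c l = 1 := by
    rw [hcdef, eval_mul_of_isHomogeneous hl, pow_one, mul_inv_cancel₀ hlp]
  set J := Ideal.span (Set.range fun i => proj l c (X i)) with hJ
  have h1 : (pointIdeal p).map (expand l c) ≤ J.map (Polynomial.C : Coord K →+* _) := by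
    rw [pointIdeal, Ideal.map_span, Ideal.span_le]
    rintro _ ⟨f, ⟨⟨n, hn⟩, hf⟩, rfl⟩
    refine expand_mem_map_C hn ?_
    rw [hcdef, eval_mul_of_isHomogeneous hn, hf, zero_mul]
  have h2 : J ≤ pointIdeal p := by
    rw [hJ, Ideal.span_le]
    rintro _ ⟨i, rfl⟩
    refine Ideal.subset_span ⟨⟨1, ?_⟩, ?_⟩
    · change (proj l c (X i)).IsHomogeneous 1
      rw [proj_X]
      exact (isHomogeneous_X _ _).sub (hl.C_mul _)
    · change eval p.rep (proj l c (X i)) = 0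
      rw [proj_X, map_sub, map_mul, eval_X, eval_C, hcdef, mul_assoc, inv_mul_cancel₀ hlp, mul_one,
        sub_self]
  have h3 : expand l c (g * l) ∈ (J ^ m).map (Polynomial.C : Coord K →+* _) := by
    rw [Ideal.map_pow]
    refine Ideal.pow_right_mono h1 m ?_
    rw [← Ideal.map_pow]
    exact Ideal.mem_map_of_mem _ hg
  rw [map_mul, expand_self hl hc, Ideal.mem_map_C_iff] at h3
  have h4 : ∀ n, (expand l c g).coeff n ∈ J ^ m := fun n => by
    simpa [Polynomial.coeff_mul_X] using h3 (n + 1)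
  rw [← eval_expand l c g, Polynomial.eval_eq_sum_range]
  exact Ideal.sum_mem _ fun n _ =>
    Ideal.mul_mem_right _ _ (Ideal.pow_right_mono h2 m (h4 n))

lemma isGraded_pointIdeal (p : Plane K) : IsGraded (pointIdeal p) :=
  isGraded_span fun _ hf => hf.1

lemma isGraded_ideal (Z : FatPointScheme K) : IsGraded Z.ideal :=
  Ideal.IsHomogeneous.iInf₂ fun p _ => isGraded_pow (isGraded_pointIdeal p) _

lemma exists_linear_eval_ne_zero [Infinite K] (s : Finset (Plane K)) :
    ∃ l : Coord K, l.IsHomogeneous 1 ∧ l ≠ 0 ∧ ∀ p ∈ s, eval p.rep l ≠ 0 := by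
  have hne : ∀ v : Fin 3 → K, v ≠ 0 → (∑ i, C (v i) * X i : Coord K) ≠ 0 := by
    intro v hv h
    obtain ⟨i, hi⟩ := Function.ne_iff.1 hv
    apply hi
    have := congrArg (eval (Pi.single i 1)) h
    simpa [Pi.single_apply] using this
  -- The coefficients of `l` are a vector where the forms dual to the points do not vanish; the
  -- factor `X 0` makes it nonzero also when there are no points.
  have hprod : (X 0 : Coord K) * ∏ p ∈ s, (∑ i, C (p.rep i) * X i : Coord K) ≠ 0 :=
    mul_ne_zero (X_ne_zero _) (Finset.prod_ne_zero_iff.2 fun p _ => hne _ p.rep_nonzero)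
  obtain ⟨a, ha⟩ : ∃ a : Fin 3 → K,
      eval a ((X 0 : Coord K) * ∏ p ∈ s, (∑ i, C (p.rep i) * X i : Coord K)) ≠ 0 := by
    by_contra! h
    exact hprod (MvPolynomial.funext fun x => by rw [h x, map_zero])
  rw [map_mul, map_prod, eval_X] at ha
  refine ⟨∑ i, C (a i) * X i, isHomogeneous_sum_C_mul_X a,
    hne a fun h => left_ne_zero_of_mul ha (by rw [h]; rfl), fun p hp => ?_⟩
  have := Finset.prod_ne_zero_iff.1 (right_ne_zero_of_mul ha) p hp
  simpa [mul_comm] using this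

/-- Some linear form is a nonzerodivisor modulo the ideal of `Z`. -/
lemma exists_linear_nonzerodivisor [Infinite K] (Z : FatPointScheme K) :
    ∃ l : Coord K, l.IsHomogeneous 1 ∧ l ≠ 0 ∧ ∀ g, g * l ∈ Z.ideal → g ∈ Z.ideal := by
  obtain ⟨l, hl, hl0, hlp⟩ := exists_linear_eval_ne_zero Z.support
  refine ⟨l, hl, hl0, fun g hg => ?_⟩
  simp only [FatPointScheme.ideal, Submodule.mem_iInf] at hg ⊢
  exact fun p hp => mem_pointIdeal_pow_of_mul_mem p _ hl (hlp p hp) (hg p hp)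

end

/-! ### Residual schemes -/

section

variable {K : Type u} [Field K] {r : ℕ} {L : Fin r → Line K} {Z : FatPointScheme K}

lemma residualIdeal_succ (j : Fin r) :
    residualIdeal Z L (j + 1) = (residualIdeal Z L j).colon {(L j).form} := by
  rw [residualIdeal, dif_pos j.2]

lemma isGraded_residualIdeal (j : ℕ) : IsGraded (residualIdeal Z L j) := by
  induction j with
  | zero => exact isGraded_ideal Z
  | succ j ih =>
    rw [residualIdeal]
    split_ifs with h
    · exact ih.colon (L ⟨j, h⟩).isHomogeneous
    · exact ih

lemma mem_residualIdeal_of_mul_mem {l : Coord K} (hl : ∀ g, g * l ∈ Z.ideal → g ∈ Z.ideal)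
    (j : ℕ) : ∀ g, g * l ∈ residualIdeal Z L j → g ∈ residualIdeal Z L j := by
  induction j with
  | zero => exact hl
  | succ j ih =>
    intro g hg
    rw [residualIdeal] at hg ⊢
    split_ifs at hg ⊢ with h
    · rw [mem_colon_iff] at hg ⊢
      rw [mul_right_comm] at hg
      exact ih _ hg
    · exact ih _ hg

lemma monotone_hilb_residualIdeal [Infinite K] (j : ℕ) :
    Monotone (hilb (residualIdeal Z L j)) := by
  obtain ⟨l, hl, hl0, hlZ⟩ := exists_linear_nonzerodivisor Z
  refine monotone_nat_of_le_succ fun t => hilb_le_succ (isGraded_residualIdeal j) hl hl0 ?_ t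
  ext g
  rw [mem_colon_iff]
  exact ⟨mem_residualIdeal_of_mul_mem hlZ j g, fun h => Ideal.mul_mem_right _ _ h⟩

end

/-! ### The two bounds as sums -/

section

variable {r : ℕ}

lemma sum_filter_lt_eq_sum_range {i : ℕ} (hi : i ≤ r) (f : ℕ → ℕ) :
    ∑ k ∈ Finset.univ.filter (fun k : Fin r => (k : ℕ) < i), f k = ∑ k ∈ Finset.range i, f k := by
  rw [Finset.sum_filter, Fin.sum_univ_eq_sum_range (fun k => if k < i then f k else 0) r,
    ← Finset.sum_filter]
  congr 1
  ext k
  simp only [Finset.mem_filter, Finset.mem_range]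
  omega

lemma sum_filter_lt_add_sum_filter_le (i : ℕ) (f : Fin r → ℕ) :
    ∑ k ∈ Finset.univ.filter (fun k : Fin r => (k : ℕ) < i), f k +
      ∑ k ∈ Finset.univ.filter (fun k : Fin r => i ≤ (k : ℕ)), f k = ∑ k, f k := by
  simpa only [not_lt] using
    Finset.sum_filter_add_sum_filter_not Finset.univ (fun k : Fin r => (k : ℕ) < i) f

lemma sum_range_add_choose (t i : ℕ) :
    ∑ k ∈ Finset.range i, (t + 1 - k) + (t + 2 - i).choose 2 = (t + 2).choose 2 := by
  induction i with
  | zero => simp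
  | succ i ih =>
    rw [Finset.sum_range_succ, ← ih, add_assoc]
    congr 1
    rcases le_or_gt i (t + 1) with h | h
    · rw [show t + 2 - (i + 1) = t + 1 - i by omega, show t + 2 - i = (t + 1 - i) + 1 by omega,
        Nat.choose_succ_succ' (t + 1 - i) 1, Nat.choose_one_right]
    · rw [show t + 2 - (i + 1) = 0 by omega, show t + 2 - i = 0 by omega,
        show t + 1 - i = 0 by omega]
      rfl

/-- The `i`-th term of the minimum that defines the upper bound. -/
lemma upperBound_term_eq {i : ℕ} (hi : i ≤ r) (d : Fin r → ℕ) (t : ℕ) :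
    (t + 2).choose 2 - (t + 2 - i).choose 2 +
        ∑ j ∈ Finset.univ.filter (fun j : Fin r => i ≤ (j : ℕ)), d j =
      ∑ k ∈ Finset.univ.filter (fun k : Fin r => (k : ℕ) < i), (t + 1 - (k : ℕ)) +
        ∑ j ∈ Finset.univ.filter (fun j : Fin r => i ≤ (j : ℕ)), d j := by
  rw [sum_filter_lt_eq_sum_range hi fun k => t + 1 - k, ← sum_range_add_choose t i,
    Nat.add_sub_cancel]

lemma lowerBound_le_upperBound (d : Fin r → ℕ) (t : ℕ) : lowerBound d t ≤ upperBound d t := by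
  rw [upperBound, Finset.le_inf'_iff]
  intro i hi
  rw [upperBound_term_eq (by simpa [Nat.lt_succ_iff] using hi), lowerBound,
    ← sum_filter_lt_add_sum_filter_le i]
  exact Nat.add_le_add (Finset.sum_le_sum fun k _ => min_le_left _ _)
    (Finset.sum_le_sum fun k _ => min_le_right _ _)

/-- If `D k + k` passes from below `T` to above `T`, for a non-increasing `D`, then it increases by
at most one at each step. So `D` is constant on a step before and on a step after a stretch with
`D k + k = T`, on which its values are consecutive integers. -/
lemma exists_runs_of_crossing {D : ℕ → ℕ} (hD : ∀ k, k + 1 < r → D (k + 1) ≤ D k) {T k l : ℕ}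
    (hkl : k < l) (hl : l < r) (hk : D k + k < T) (hlT : T < D l + l) :
    ∃ i j : ℕ, 0 < j ∧ i + j + 1 < r ∧ D i = D (i + 1) ∧ D (i + j) = D (i + j + 1) ∧
      ∀ n, i + 1 ≤ n → n < i + j → D n = D (n + 1) + 1 := by
  classical
  -- `i` is the last index before `l` at which `D k + k` is below `T`, and `m` the first one after
  -- it at which `D k + k` is above `T`.
  set i := Nat.findGreatest (fun n => D n + n < T) l with hidef
  have hi : D i + i < T := Nat.findGreatest_spec (P := fun n => D n + n < T) hkl.le hk
  have hil : i ≤ l := Nat.findGreatest_le l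
  have himax : ∀ n, i < n → n ≤ l → T ≤ D n + n := fun n h1 h2 =>
    not_lt.1 (Nat.findGreatest_is_greatest (P := fun n => D n + n < T) h1 h2)
  have hex : ∃ n, i < n ∧ T < D n + n :=
    ⟨l, lt_of_le_of_ne hil fun e => by rw [e] at hi; omega, hlT⟩
  set m := Nat.find hex with hmdef
  obtain ⟨him, hm⟩ : i < m ∧ T < D m + m := Nat.find_spec hex
  have hml : m ≤ l := Nat.find_min' hex ⟨lt_of_le_of_ne hil fun e => by rw [e] at hi; omega, hlT⟩
  have hmid : ∀ n, i < n → n < m → D n + n = T := fun n h1 h2 => by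
    have h3 := himax n h1 (by omega)
    have h4 : ¬ (i < n ∧ T < D n + n) := Nat.find_min hex h2
    omega
  clear_value i m
  obtain ⟨j, rfl⟩ : ∃ j, m = i + j + 1 := ⟨m - i - 1, by omega⟩
  have h1 := hD i (by omega)
  have hj : 0 < j := by
    rcases Nat.eq_zero_or_pos j with rfl | h
    · simp only [add_zero] at hm h1
      omega
    · exact h
  have h2 := hmid (i + 1) (by omega) (by omega)
  have h3 := hmid (i + j) (by omega) (by omega)
  have h4 := hD (i + j) (by omega)
  refine ⟨i, j, hj, by omega, by omega, by omega, fun n hn1 hn2 => ?_⟩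
  have h5 := hmid n (by omega) (by omega)
  have h6 := hmid (n + 1) (by omega) (by omega)
  omega

/-- Without the excluded patterns, `d k - (t + 1 - k)` does not pass from negative to positive. -/
lemma le_of_no_runs {d : Fin r → ℕ} (hd : Antitone d) (h3 : ¬ HasTripleRun d)
    (hs : ¬ HasStairRun d) {t : ℕ} {k l : Fin r} (hkl : k < l) (hk : d k < t + 1 - (k : ℕ)) :
    d l ≤ t + 1 - (l : ℕ) := by
  by_contra! hl
  let D : ℕ → ℕ := fun n => if h : n < r then d ⟨n, h⟩ else 0
  have hDn : ∀ n (h : n < r), D n = d ⟨n, h⟩ := fun n h => dif_pos h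
  have hD : ∀ n, n + 1 < r → D (n + 1) ≤ D n := fun n h => by
    rw [hDn _ h, hDn n (by omega)]
    exact hd (Fin.mk_le_mk.2 (Nat.le_succ n))
  obtain ⟨i, j, hj, hijr, h1, h2, h4⟩ := exists_runs_of_crossing hD (T := t + 1) hkl l.2
    (by rw [hDn _ k.2, Fin.eta]; omega)
    (by rw [hDn _ l.2, Fin.eta]; omega)
  rcases Nat.lt_or_ge 1 j with hj1 | hj1
  · refine hs ⟨i, j, hijr, hj1, ?_, ?_, fun n hn1 hn2 => ?_⟩
    · rw [← hDn, ← hDn]; exact h1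
    · rw [← hDn, ← hDn]; exact h2
    · rw [← hDn, ← hDn]; exact h4 n hn1 hn2
  · obtain rfl : j = 1 := by omega
    refine h3 ⟨i, hijr, ?_, ?_⟩
    · rw [← hDn, ← hDn]; exact h1
    · rw [← hDn, ← hDn]; exact h2

/-- At each `t`, the term of the minimum that equals the lower bound is the one at the first index
`k` with `d k < t + 1 - k`. -/
lemma lowerBound_eq_upperBound {d : Fin r → ℕ} (hd : Antitone d) (h3 : ¬ HasTripleRun d)
    (hs : ¬ HasStairRun d) : lowerBound d = upperBound d := by
  funext t
  refine le_antisymm (lowerBound_le_upperBound d t) ?_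
  obtain ⟨i, hir, hlt, hge⟩ : ∃ i ≤ r, (∀ k : Fin r, (k : ℕ) < i → t + 1 - (k : ℕ) ≤ d k) ∧
      ∀ k : Fin r, i ≤ (k : ℕ) → d k ≤ t + 1 - (k : ℕ) := by
    classical
    by_cases h : ∃ i : ℕ, ∃ hi : i < r, d ⟨i, hi⟩ < t + 1 - i
    · obtain ⟨hi, hid⟩ := Nat.find_spec h
      refine ⟨Nat.find h, hi.le, fun k hk => ?_, fun k hk => ?_⟩
      · by_contra! hlt
        exact Nat.find_min h hk ⟨k.2, hlt⟩
      · rcases hk.eq_or_lt with he | hlt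
        · have : k = ⟨Nat.find h, hi⟩ := Fin.ext he.symm
          rw [this]
          exact hid.le
        · exact le_of_no_runs hd h3 hs (k := ⟨Nat.find h, hi⟩) (Fin.lt_def.2 hlt) hid
    · push Not at h
      exact ⟨r, le_rfl, fun k _ => h k k.2, fun k hk => absurd k.2 (not_lt.2 hk)⟩
  refine (Finset.inf'_le _ (Finset.mem_range.2 (Nat.lt_succ_of_le hir))).trans ?_
  rw [upperBound_term_eq hir, lowerBound, ← sum_filter_lt_add_sum_filter_le i]
  refine Nat.add_le_add (Finset.sum_le_sum fun k hk => ?_) (Finset.sum_le_sum fun k hk => ?_)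
  · exact le_min le_rfl (hlt k (Finset.mem_filter.1 hk).2)
  · exact le_min (hge k (Finset.mem_filter.1 hk).2) le_rfl

lemma not_hasTripleRun_of_strictAnti {d : Fin r → ℕ} (hd : StrictAnti d) : ¬ HasTripleRun d := by
  rintro ⟨i, hi, h1, -⟩
  exact absurd (hd.injective h1) (by simp)

lemma not_hasStairRun_of_strictAnti {d : Fin r → ℕ} (hd : StrictAnti d) : ¬ HasStairRun d := by
  rintro ⟨i, j, hi, hj, h1, -⟩
  exact absurd (hd.injective h1) (by simp)

end

/-! ### Bounds on the Hilbert function -/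

section

variable {K : Type u} [Field K] {r : ℕ} {L : Fin r → Line K} {Z : FatPointScheme K}
  {d : Fin r → ℕ}

lemma hilb_residualIdeal_step (k : Fin r) (t : ℕ) :
    (if (k : ℕ) ≤ t then hilb (residualIdeal Z L k) (t - k) else 0) =
      (if (k : ℕ) ≤ t then hilb (residualIdeal Z L k ⊔ Ideal.span {(L k).form}) (t - k) else 0) +
        if (k : ℕ) + 1 ≤ t then hilb (residualIdeal Z L (k + 1)) (t - (k + 1)) else 0 := by
  have hg : IsGraded (residualIdeal Z L k) := isGraded_residualIdeal k
  rcases lt_trichotomy (k : ℕ) t with h | h | h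
  · obtain ⟨s, rfl⟩ := Nat.exists_eq_add_of_lt h
    rw [if_pos h.le, if_pos h.le, if_pos (show (k : ℕ) + 1 ≤ k + s + 1 by omega),
      show (k : ℕ) + s + 1 - k = s + 1 by omega, show (k : ℕ) + s + 1 - (k + 1) = s by omega,
      residualIdeal_succ, hilb_succ hg (L k).isHomogeneous (L k).ne_zero, add_comm]
  · rw [if_pos h.le, if_pos h.le, if_neg (by omega), h, Nat.sub_self, add_zero, ← h]
    exact hilb_zero hg (L k).isHomogeneous
  · rw [if_neg (by omega), if_neg (by omega), if_neg (by omega)]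

/-- The Hilbert function of a residual is the sum of those of the further sections, each shifted
by the number of lines removed before. -/
lemma hilb_residualIdeal_eq_sum (hL : TotallyReduces L Z) (t : ℕ) {i : ℕ} (hi : i ≤ r) :
    (if i ≤ t then hilb (residualIdeal Z L i) (t - i) else 0) =
      ∑ k ∈ Finset.univ.filter (fun k : Fin r => i ≤ (k : ℕ)),
        if (k : ℕ) ≤ t then hilb (residualIdeal Z L k ⊔ Ideal.span {(L k).form}) (t - k) else 0 := by
  induction hi using Nat.decreasingInduction with
  | self =>
    rw [show residualIdeal Z L r = ⊤ from hL, hilb_top, ite_self]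
    exact (Finset.sum_eq_zero fun k hk =>
      absurd k.2 (not_lt.2 (Finset.mem_filter.1 hk).2)).symm
  | of_succ i hi ih =>
    have hins : Finset.univ.filter (fun k : Fin r => i ≤ (k : ℕ)) =
        insert ⟨i, hi⟩ (Finset.univ.filter (fun k : Fin r => i + 1 ≤ (k : ℕ))) := by
      ext k
      simp only [Finset.mem_filter, Finset.mem_univ, true_and, Finset.mem_insert, Fin.ext_iff]
      omega
    rw [hins, Finset.sum_insert (by simp), ← ih]
    exact hilb_residualIdeal_step ⟨i, hi⟩ t

lemma hilb_eq_sum (hL : TotallyReduces L Z) (t : ℕ) :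
    Z.hilb t = ∑ k : Fin r,
      if (k : ℕ) ≤ t then hilb (residualIdeal Z L k ⊔ Ideal.span {(L k).form}) (t - k) else 0 := by
  have h := hilb_residualIdeal_eq_sum hL t (Nat.zero_le r)
  rw [if_pos (Nat.zero_le t), Finset.filter_true_of_mem fun k _ => Nat.zero_le _] at h
  exact h

lemma min_le_hilb_section [Infinite K] (hd : IsReductionVector Z L d) (k : Fin r) (t : ℕ) :
    min (t + 1) (d k) ≤ hilb (residualIdeal Z L k ⊔ Ideal.span {(L k).form}) t :=
  min_le_hilb (L k).isHomogeneous (L k).ne_zero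
    ((isGraded_residualIdeal k).sup (isGraded_span_singleton (L k).isHomogeneous))
    (Ideal.mem_sup_right (Ideal.mem_span_singleton_self _)) (hd k) t

lemma min_le_shifted_section [Infinite K] (hd : IsReductionVector Z L d) (k : Fin r) (t : ℕ) :
    min (t + 1 - (k : ℕ)) (d k) ≤
      if (k : ℕ) ≤ t then hilb (residualIdeal Z L k ⊔ Ideal.span {(L k).form}) (t - k) else 0 := by
  split_ifs with h
  · rw [show t + 1 - (k : ℕ) = t - k + 1 by omega]
    exact min_le_hilb_section hd k _
  · rw [show t + 1 - (k : ℕ) = 0 by omega, Nat.zero_min]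

lemma lowerBound_le_hilb [Infinite K] (h : IsFullReductionVector Z L d) (t : ℕ) :
    lowerBound d t ≤ Z.hilb t := by
  rw [hilb_eq_sum h.1]
  exact Finset.sum_le_sum fun k _ => min_le_shifted_section h.2 k t

/-- The Hilbert function of a residual is bounded by its degree. -/
lemma hilb_residualIdeal_le [Infinite K] (h : IsFullReductionVector Z L d) {i : ℕ} (hi : i ≤ r)
    (t : ℕ) :
    (if i ≤ t then hilb (residualIdeal Z L i) (t - i) else 0) ≤
      ∑ k ∈ Finset.univ.filter (fun k : Fin r => i ≤ (k : ℕ)), d k := by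
  obtain ⟨N, hN⟩ : ∃ N, ∀ n ≥ N, ∀ k : Fin r,
      hilb (residualIdeal Z L k ⊔ Ideal.span {(L k).form}) n = d k :=
    Filter.eventually_atTop.1 (Filter.eventually_all.2 h.2)
  have h1 := hilb_residualIdeal_eq_sum h.1 (t + N + r) hi
  rw [if_pos (by omega)] at h1
  have h2 : hilb (residualIdeal Z L i) (t + N + r - i) =
      ∑ k ∈ Finset.univ.filter (fun k : Fin r => i ≤ (k : ℕ)), d k := by
    rw [h1]
    refine Finset.sum_congr rfl fun k _ => ?_
    have := k.2
    rw [if_pos (by omega), hN _ (by omega)]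
  rw [← h2]
  split_ifs with hit
  · exact monotone_hilb_residualIdeal i (by omega)
  · exact Nat.zero_le _

lemma hilb_le_upperBound [Infinite K] (h : IsFullReductionVector Z L d) (t : ℕ) :
    Z.hilb t ≤ upperBound d t := by
  rw [upperBound, Finset.le_inf'_iff]
  intro i hi
  have hir : i ≤ r := by simpa [Nat.lt_succ_iff] using hi
  rw [upperBound_term_eq hir, hilb_eq_sum h.1, ← sum_filter_lt_add_sum_filter_le i]
  refine Nat.add_le_add (Finset.sum_le_sum fun k _ => ?_) ?_
  · split_ifs with hk
    · rw [show t + 1 - (k : ℕ) = t - k + 1 by omega]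
      exact hilb_le_of_mem (L k).isHomogeneous (L k).ne_zero
        (Ideal.mem_sup_right (Ideal.mem_span_singleton_self _)) _
    · exact Nat.zero_le _
  · rw [← hilb_residualIdeal_eq_sum h.1 t hir]
    exact hilb_residualIdeal_le h hir t

/-- If the two bounds agree, then every section has the least Hilbert function possible. -/
lemma hilb_section_eq [Infinite K] (h : IsFullReductionVector Z L d)
    (hb : lowerBound d = upperBound d) (k : Fin r) (t : ℕ) :
    hilb (residualIdeal Z L k ⊔ Ideal.span {(L k).form}) t = min (t + 1) (d k) := by
  have h1 : lowerBound d (t + k) = Z.hilb (t + k) :=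
    le_antisymm (lowerBound_le_hilb h _) ((hilb_le_upperBound h _).trans_eq (by rw [hb]))
  rw [hilb_eq_sum h.1, lowerBound] at h1
  have h2 := (Finset.sum_eq_sum_iff_of_le
    fun i _ => min_le_shifted_section h.2 i (t + k)).1 h1 k (Finset.mem_univ k)
  rw [if_pos (Nat.le_add_left _ _), Nat.add_sub_cancel,
    show t + (k : ℕ) + 1 - k = t + 1 by omega] at h2
  exact h2.symm

end

/-! ### Minimal resolutions of length one -/

section

variable {K : Type u} [Field K] {ι κ : Type*}

lemma linearCombination_eq_sum [Fintype ι] (g : ι → Coord K) (x : ι →₀ Coord K) :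
    Finsupp.linearCombination (Coord K) g x = ∑ a, x a * g a := by
  rw [Finsupp.linearCombination_apply]
  exact Finsupp.sum_fintype _ _ fun _ => zero_smul _ _

/-- The forms `g a`, of degrees `e a`, generate `I`, and the syzygies `s b`, of degrees `e' b`, are
a basis of the relations among them; the entries of the syzygies are forms of positive degree
(or zero), so that both sets are minimal. -/
structure IsMinimalResolution (I : Ideal (Coord K)) (e : ι → ℕ) (e' : κ → ℕ) (g : ι → Coord K)
    (s : κ → ι →₀ Coord K) : Prop where
  isHomogeneous : ∀ a, (g a).IsHomogeneous (e a)
  entry : ∀ b a, s b a = 0 ∨ (e a < e' b ∧ (s b a).IsHomogeneous (e' b - e a))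
  span_eq : Ideal.span (Set.range g) = I
  exact : ∀ x, Finsupp.linearCombination (Coord K) g x = 0 ↔
    x ∈ Submodule.span (Coord K) (Set.range s)
  linearIndependent : LinearIndependent (Coord K) s

/-- `I` has a minimal graded free resolution of length one whose generators and syzygies have the
degrees `e` and `e'`. -/
def HasMinimalResolution (I : Ideal (Coord K)) (e : ι → ℕ) (e' : κ → ℕ) : Prop :=
  ∃ (g : ι → Coord K) (s : κ → ι →₀ Coord K), IsMinimalResolution I e e' g s

lemma hasGradedBetti_iff {I : Ideal (Coord K)} {ν σ : ℕ → ℕ} :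
    HasGradedBetti I ν σ ↔ HasMinimalResolution I (Sigma.fst : (Σ j : ℕ, Fin (ν j)) → ℕ)
      (Sigma.fst : (Σ j : ℕ, Fin (σ j)) → ℕ) := by
  constructor
  · rintro ⟨φ₀, φ₁, h0, h1, hr, hk, hi⟩
    have e0 : φ₀ = Finsupp.linearCombination (Coord K) fun a => φ₀ (Finsupp.single a 1) := by
      ext a
      simp
    have e1 : φ₁ = Finsupp.linearCombination (Coord K) fun b => φ₁ (Finsupp.single b 1) := by
      ext b a
      simp
    refine ⟨fun a => φ₀ (Finsupp.single a 1), fun b => φ₁ (Finsupp.single b 1), h0, h1, ?_,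
      fun x => ?_, ?_⟩
    · rw [← hr, e0, Finsupp.range_linearCombination, ← e0]
    · rw [← e0, ← Finsupp.range_linearCombination, ← e1, hk, LinearMap.mem_ker]
    · rw [LinearIndependent, ← e1]
      exact hi
  · rintro ⟨g, s, h⟩
    refine ⟨Finsupp.linearCombination (Coord K) g, Finsupp.linearCombination (Coord K) s,
      fun a => ?_, fun b a => ?_, ?_, ?_, h.linearIndependent⟩
    · simpa using h.isHomogeneous a
    · simpa using h.entry b a
    · rw [Finsupp.range_linearCombination]
      exact h.span_eq
    · ext x
      rw [LinearMap.mem_ker, h.exact, Finsupp.range_linearCombination]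

lemma HasMinimalResolution.reindex {ι' κ' : Type*} {I : Ideal (Coord K)} {e : ι → ℕ} {e' : κ → ℕ}
    (h : HasMinimalResolution I e e') (f : ι' ≃ ι) (f' : κ' ≃ κ) {e₂ : ι' → ℕ} {e₂' : κ' → ℕ}
    (he : ∀ a, e (f a) = e₂ a) (he' : ∀ b, e' (f' b) = e₂' b) :
    HasMinimalResolution I e₂ e₂' := by
  obtain rfl : e ∘ f = e₂ := funext he
  obtain rfl : e' ∘ f' = e₂' := funext he'
  obtain ⟨g, s, h⟩ := h
  let T : (ι →₀ Coord K) ≃ₗ[Coord K] (ι' →₀ Coord K) := Finsupp.domLCongr f.symm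
  have hT : ∀ x a, T x a = x (f a) := fun x a => by
    simp [T, Finsupp.domLCongr_apply, Finsupp.equivMapDomain_apply]
  have hg : ∀ x, Finsupp.linearCombination (Coord K) (g ∘ f) (T x) =
      Finsupp.linearCombination (Coord K) g x := fun x => by
    change Finsupp.linearCombination (Coord K) (g ∘ f) (Finsupp.equivMapDomain f.symm x) = _
    rw [Finsupp.linearCombination_equivMapDomain]
    congr 2
    ext a
    simp
  refine ⟨g ∘ f, fun b => T (s (f' b)), fun a => h.isHomogeneous (f a), fun b a => ?_, ?_,
    fun x => ?_, ?_⟩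
  · rw [hT]
    exact h.entry _ _
  · rw [f.surjective.range_comp, h.span_eq]
  · obtain ⟨y, rfl⟩ := T.surjective x
    have hr : Set.range (fun b => T (s (f' b))) = T.toLinearMap '' Set.range s := by
      rw [← f'.surjective.range_comp s, ← Set.range_comp]
      rfl
    rw [hg, h.exact, hr, ← Submodule.map_span]
    exact ⟨fun hy => ⟨y, hy, rfl⟩, fun ⟨z, hz, hzy⟩ => T.injective hzy ▸ hz⟩
  · exact (h.linearIndependent.comp f' f'.injective).map' T.toLinearMap T.ker

lemma HasMinimalResolution.hasGradedBetti [Fintype ι] [Fintype κ] {I : Ideal (Coord K)}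
    {e : ι → ℕ} {e' : κ → ℕ} (h : HasMinimalResolution I e e') :
    HasGradedBetti I (fun t => Fintype.card {a // e a = t}) fun t => Fintype.card {b // e' b = t} :=
  hasGradedBetti_iff.2 <| h.reindex
    ((Equiv.sigmaCongrRight fun t => (Fintype.equivFin {a // e a = t}).symm).trans
      (Equiv.sigmaFiberEquiv e))
    ((Equiv.sigmaCongrRight fun t => (Fintype.equivFin {b // e' b = t}).symm).trans
      (Equiv.sigmaFiberEquiv e'))
    (fun a => ((Fintype.equivFin {i // e i = a.1}).symm a.2).2)
    (fun b => ((Fintype.equivFin {i // e' i = b.1}).symm b.2).2)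

/-- Let `I' = I : F` for a linear form `F` and `I = F I' + (G)` for a form `G` not divisible by `F`.
A minimal resolution of `I'` whose generators have degrees below that of `G` gives one of `I`: as
`G` lies in `I'`, the product `F G` is a combination of the generators of `F I'`, and this is the
only new syzygy. The index `none` stands for the new generator and the new syzygy. -/
lemma HasMinimalResolution.step [Infinite K] [Fintype ι] {I : Ideal (Coord K)} {F G : Coord K}
    {n : ℕ} (hF : F.IsHomogeneous 1) (hF0 : F ≠ 0) (hGI : G ∈ I) (hG : G.IsHomogeneous n)
    (hGF : G ∉ Ideal.span {F}) (hI : I ≤ Ideal.span {F} ⊔ Ideal.span {G}) {e : ι → ℕ} {e' : κ → ℕ}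
    (h : HasMinimalResolution (I.colon {F}) e e') (hen : ∀ a, e a < n) :
    HasMinimalResolution I (fun a : Option ι => a.elim n fun a => e a + 1)
      (fun b : Option κ => b.elim (n + 1) fun b => e' b + 1) := by
  obtain ⟨g, s, h⟩ := h
  -- Homogeneous coefficients that express `G` through the generators of `I : F`.
  obtain ⟨c, hc, hcG⟩ : ∃ c : ι →₀ Coord K, (∀ a, (c a).IsHomogeneous (n - e a)) ∧
      Finsupp.linearCombination (Coord K) g c = G := by
    have hG' : G ∈ Ideal.span (Set.range g) := by
      rw [h.span_eq, mem_colon_iff]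
      exact I.mul_mem_right _ hGI
    obtain ⟨c, hc⟩ := (Submodule.mem_span_range_iff_exists_fun _).1 hG'
    refine ⟨Finsupp.equivFunOnFinite.symm fun a => homogeneousComponent (n - e a) (c a),
      fun a => homogeneousComponent_isHomogeneous _ _, ?_⟩
    rw [linearCombination_eq_sum,
      ← homogeneousComponent_eq_self hG, ← hc, map_sum]
    refine Finset.sum_congr rfl fun a _ => ?_
    rw [smul_eq_mul, homogeneousComponent_mul_of_isHomogeneous (h.isHomogeneous a),
      if_pos (hen a).le]
    rfl
  let emb : (ι →₀ Coord K) →ₗ[Coord K] (Option ι →₀ Coord K) :=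
    Finsupp.lmapDomain (Coord K) (Coord K) some
  have hemb_none : ∀ y, emb y none = 0 := fun y =>
    Finsupp.mapDomain_of_notMem_range _ _ (by simp)
  have hemb_some : ∀ y a, emb y (some a) = y a := fun y a =>
    Finsupp.mapDomain_apply (Option.some_injective _) _ _
  have hemb_inj : Function.Injective emb := Finsupp.mapDomain_injective (Option.some_injective _)
  set g' : Option ι → Coord K := fun a => a.elim G fun a => g a * F with hg'
  have hg'emb : ∀ y, Finsupp.linearCombination (Coord K) g' (emb y) =
      Finsupp.linearCombination (Coord K) g y * F := fun y => by
    change Finsupp.linearCombination (Coord K) g' (Finsupp.mapDomain some y) = _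
    rw [Finsupp.linearCombination_mapDomain, Finsupp.linearCombination_apply,
      Finsupp.linearCombination_apply, Finsupp.sum_mul]
    simp [hg', mul_assoc]
  set s₀ : Option ι →₀ Coord K := Finsupp.single none F - emb c with hs₀
  have hs₀none : s₀ none = F := by simp [hs₀, hemb_none]
  have hs₀some : ∀ a, s₀ (some a) = -c a := fun a => by simp [hs₀, hemb_some]
  have hs₀g : Finsupp.linearCombination (Coord K) g' s₀ = 0 := by
    rw [hs₀, map_sub, hg'emb, hcG, Finsupp.linearCombination_single, smul_eq_mul]
    change F * G - G * F = 0
    ring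
  set s' : Option κ → Option ι →₀ Coord K := fun b => b.elim s₀ fun b => emb (s b) with hs'
  have hs'span : Submodule.span (Coord K) (Set.range s') =
      Submodule.span (Coord K) {s₀} ⊔ (Submodule.span (Coord K) (Set.range s)).map emb := by
    rw [Submodule.map_span, ← Submodule.span_union, ← Set.range_comp]
    congr 1
    ext x
    simp only [Set.mem_range, Option.exists, Set.mem_union, Set.mem_singleton_iff, hs',
      Option.elim, Function.comp_apply]
    exact or_congr_left eq_comm
  refine ⟨g', s', ?_, ?_, ?_, ?_, ?_⟩
  · rintro (_ | a)
    · exact hG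
    · exact (h.isHomogeneous a).mul hF
  · rintro (_ | b) (_ | a)
    · right
      simp only [hs', Option.elim, hs₀none]
      exact ⟨Nat.lt_succ_self n, by rwa [Nat.add_sub_cancel_left]⟩
    · right
      simp only [hs', Option.elim, hs₀some]
      refine ⟨Nat.succ_lt_succ (hen a), ?_⟩
      rw [Nat.add_sub_add_right]
      exact (hc a).neg
    · left
      exact hemb_none _
    · simp only [hs', Option.elim, hemb_some]
      rw [Nat.add_sub_add_right]
      exact (h.entry b a).imp_right fun h => ⟨Nat.succ_lt_succ h.1, h.2⟩
  · apply le_antisymm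
    · rw [Ideal.span_le]
      rintro _ ⟨_ | a, rfl⟩
      · exact hGI
      · refine mem_colon_iff.1 ?_
        rw [← h.span_eq]
        exact Ideal.subset_span ⟨a, rfl⟩
    · intro f hf
      obtain ⟨x, hx, y, hy, rfl⟩ := Submodule.mem_sup.1 (hI hf)
      obtain ⟨u, rfl⟩ := Ideal.mem_span_singleton'.1 hx
      obtain ⟨v, rfl⟩ := Ideal.mem_span_singleton'.1 hy
      have hu : u ∈ Ideal.span (Set.range g) := by
        rw [h.span_eq, mem_colon_iff]
        exact (I.add_mem_iff_left (I.mul_mem_left _ hGI)).1 hf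
      obtain ⟨y, rfl⟩ := (Finsupp.mem_span_range_iff_exists_finsupp).1 hu
      refine Ideal.add_mem _ ?_ (Ideal.mul_mem_left _ _ (Ideal.subset_span ⟨none, rfl⟩))
      have := hg'emb y
      rw [Finsupp.linearCombination_apply (Coord K) (v := g)] at this
      rw [← this]
      exact (Finsupp.range_linearCombination (Coord K) (v := g')).le ⟨_, rfl⟩
  · intro x
    rw [hs'span]
    constructor
    · intro hx
      have hx2 : x none * G + (∑ a, x (some a) * g a) * F = 0 := by
        rw [Finsupp.linearCombination_option] at hx
        rw [← hx, linearCombination_eq_sum, Finset.sum_mul]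
        simp [hg', mul_assoc]
      -- `F` divides `x none * G`, so it divides `x none`, and subtracting a multiple of the new
      -- syzygy leaves a relation among the generators of `F I'`.
      have hxF : x none ∈ Ideal.span {F} := by
        refine ((isPrime_span_singleton hF hF0).mem_or_mem (y := G) ?_).resolve_right hGF
        rw [eq_neg_of_add_eq_zero_left hx2]
        exact neg_mem (Ideal.mul_mem_left _ _ (Ideal.mem_span_singleton_self F))
      obtain ⟨u, hu⟩ := Ideal.mem_span_singleton'.1 hxF
      obtain ⟨y, hy⟩ : ∃ y, emb y = x - u • s₀ := by
        refine ⟨(x - u • s₀).some, ?_⟩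
        ext (_ | a)
        · rw [hemb_none, Finsupp.sub_apply, Finsupp.smul_apply, hs₀none, ← hu, smul_eq_mul,
            sub_self]
        · rw [hemb_some, Finsupp.some_apply]
      have hyg : Finsupp.linearCombination (Coord K) g y = 0 := by
        have := hg'emb y
        rw [hy, map_sub, map_smul, hx, hs₀g, smul_zero, sub_zero] at this
        exact (mul_eq_zero.1 this.symm).resolve_right hF0
      rw [← sub_add_cancel x (u • s₀), ← hy, add_comm]
      exact Submodule.add_mem_sup (Submodule.smul_mem _ _ (Submodule.mem_span_singleton_self _))
        ⟨y, (h.exact y).1 hyg, rfl⟩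
    · intro hx
      have hle : Submodule.span (Coord K) {s₀} ⊔
          (Submodule.span (Coord K) (Set.range s)).map emb ≤
            LinearMap.ker (Finsupp.linearCombination (Coord K) g') := by
        rw [sup_le_iff, Submodule.span_singleton_le_iff_mem]
        refine ⟨hs₀g, ?_⟩
        rintro _ ⟨y, hy, rfl⟩
        rw [LinearMap.mem_ker, hg'emb, (h.exact y).2 hy, zero_mul]
      exact hle hx
  · rw [linearIndependent_iff]
    intro z hz
    rw [Finsupp.linearCombination_option] at hz
    have hz' : Finsupp.linearCombination (Coord K) (s' ∘ some) z.some =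
        emb (Finsupp.linearCombination (Coord K) s z.some) := by
      rw [Finsupp.apply_linearCombination]
      rfl
    rw [hz'] at hz
    have hz0 : z none = 0 := by
      have := DFunLike.congr_fun hz none
      rw [Finsupp.add_apply, hemb_none, add_zero, Finsupp.smul_apply, smul_eq_mul] at this
      change z none * s₀ none = 0 at this
      rw [hs₀none] at this
      exact (mul_eq_zero.1 this).resolve_right hF0
    rw [hz0, zero_smul, zero_add] at hz
    have hz1 := linearIndependent_iff.1 h.linearIndependent z.some
      (hemb_inj (by rw [hz, map_zero]))
    ext1 (_ | b)
    · exact hz0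
    · exact DFunLike.congr_fun hz1 b

end

/-! ### The resolution determined by a strictly decreasing reduction vector -/

section

variable {K : Type u} [Field K]

/-- The degrees of the generators: `d k + k` for `k < n`, and `n` for the last one, the product of
the linear forms. -/
def generatorDegree {n : ℕ} (d : Fin n → ℕ) (k : Fin (n + 1)) : ℕ :=
  (if h : (k : ℕ) < n then d ⟨k, h⟩ else 0) + k

/-- The degrees of the syzygies: `d k + k + 1` for `k < n`. -/
def syzygyDegree {n : ℕ} (d : Fin n → ℕ) (k : Fin n) : ℕ := d k + k + 1

lemma add_le_of_strictAnti {n : ℕ} {d : Fin (n + 1) → ℕ} (hd : StrictAnti d) :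
    ∀ (k : ℕ) (hk : k < n + 1), d ⟨k, hk⟩ + k ≤ d 0
  | 0, _ => le_rfl
  | k + 1, hk => by
    have h1 := add_le_of_strictAnti hd k (by omega)
    have h2 : d ⟨k + 1, hk⟩ < d ⟨k, by omega⟩ := hd (Fin.mk_lt_mk.2 (Nat.lt_succ_self k))
    omega

/-- This inequality makes the resolution minimal; it is where the strict decrease of `d` enters. -/
lemma generatorDegree_succ_lt {n : ℕ} {d : Fin (n + 1) → ℕ} (hd : StrictAnti d)
    (hpos : ∀ k, 0 < d k) (k : Fin (n + 1)) : generatorDegree (d ∘ Fin.succ) k < d 0 := by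
  rw [generatorDegree]
  split_ifs with h
  · have := add_le_of_strictAnti hd (k + 1) (by omega)
    change d ⟨k + 1, by omega⟩ + k < d 0
    omega
  · have h1 := add_le_of_strictAnti hd n (by omega)
    have h2 := hpos ⟨n, by omega⟩
    have := k.2
    omega

/-- The empty scheme: one generator of degree `0`. -/
lemma hasMinimalResolution_top :
    HasMinimalResolution (⊤ : Ideal (Coord K)) (generatorDegree (Fin.elim0 : Fin 0 → ℕ))
      (syzygyDegree (Fin.elim0 : Fin 0 → ℕ)) := by
  refine ⟨fun _ => 1, Fin.elim0, fun a => ?_, fun b => b.elim0, ?_, fun x => ?_,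
    linearIndependent_empty_type⟩
  · obtain rfl : a = (0 : Fin 1) := Fin.fin_one_eq_zero a
    exact isHomogeneous_one _ _
  · rw [Set.range_const, Ideal.span_singleton_one]
  · rw [linearCombination_eq_sum,
      Set.range_eq_empty, Submodule.span_empty, Submodule.mem_bot, Finsupp.ext_iff]
    simp [Fin.forall_fin_one]

/-- The resolution built by adding the lines of a reduction one at a time. -/
lemma hasMinimalResolution_of_chain [Infinite K] : ∀ {n : ℕ} {d : Fin n → ℕ} (_ : StrictAnti d)
    (_ : ∀ k, 0 < d k) {I : ℕ → Ideal (Coord K)} {F : Fin n → Coord K} (_ : I n = ⊤)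
    (_ : ∀ k, (F k).IsHomogeneous 1 ∧ F k ≠ 0) (_ : ∀ k : Fin n, I (k + 1) = (I k).colon {F k})
    (_ : ∀ k : Fin n, ∃ G ∈ I k, G.IsHomogeneous (d k) ∧ G ∉ Ideal.span {F k} ∧
      I k ≤ Ideal.span {F k} ⊔ Ideal.span {G}),
    HasMinimalResolution (I 0) (generatorDegree d) (syzygyDegree d)
  | 0, d, _, _, I, F, h, _, _, _ => by
    rw [h]
    convert hasMinimalResolution_top
  | n + 1, d, hd, hpos, I, F, h, hF, hI, hG => by
    have ih := hasMinimalResolution_of_chain (d := d ∘ Fin.succ)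
      (hd.comp_strictMono (Fin.strictMono_succ)) (fun k => hpos _) (I := fun k => I (k + 1))
      (F := F ∘ Fin.succ) h (fun k => hF _) (fun k => hI k.succ) (fun k => hG k.succ)
    obtain ⟨G, hGI, hG, hGF, hle⟩ := hG 0
    have hI0 : I (0 + 1) = (I 0).colon {F 0} := hI 0
    rw [hI0] at ih
    refine (ih.step (hF 0).1 (hF 0).2 hGI hG hGF hle (generatorDegree_succ_lt hd hpos)).reindex
      (finSuccEquiv (n + 1)) (finSuccEquiv n) (fun k => ?_) (fun k => ?_)
    · refine Fin.cases ?_ (fun k => ?_) k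
      · simp [generatorDegree]
      · simp [generatorDegree, add_assoc]
    · refine Fin.cases ?_ (fun k => ?_) k
      · simp [syzygyDegree]
      · simp [syzygyDegree, add_assoc]

lemma hasGradedBetti_of_strictAnti [Infinite K] {r : ℕ} {L : Fin r → Line K}
    {Z : FatPointScheme K} {d : Fin r → ℕ} (h : IsFullReductionVector Z L d) (hd : StrictAnti d)
    (hpos : ∀ k, 0 < d k) :
    HasGradedBetti Z.ideal (fun t => Fintype.card {a // generatorDegree d a = t})
      fun t => Fintype.card {b // syzygyDegree d b = t} := by
  have hb := lowerBound_eq_upperBound hd.antitone (not_hasTripleRun_of_strictAnti hd)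
    (not_hasStairRun_of_strictAnti hd)
  exact (hasMinimalResolution_of_chain hd hpos (I := residualIdeal Z L) (F := fun k => (L k).form)
    h.1 (fun k => ⟨(L k).isHomogeneous, (L k).ne_zero⟩) residualIdeal_succ fun k =>
      le_sup_span_of_hilb_eq (L k).isHomogeneous (L k).ne_zero (isGraded_residualIdeal k)
        (hilb_section_eq h hb k)).hasGradedBetti

end

/-! ### Uniqueness of the graded Betti numbers -/

section

variable {K : Type u} [Field K] {ι κ : Type*}

/-- The elements of degree `t` of the graded free module whose basis vectors have degrees `e`. -/
noncomputable def degreePart (K : Type u) [Field K] (e : ι → ℕ) (t : ℕ) :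
    Submodule K (ι →₀ Coord K) where
  carrier := {x | ∀ a, (e a ≤ t → (x a).IsHomogeneous (t - e a)) ∧ (t < e a → x a = 0)}
  zero_mem' := fun _ => ⟨fun _ => isHomogeneous_zero _ _ _, fun _ => rfl⟩
  add_mem' := fun {x y} hx hy a =>
    ⟨fun h => ((hx a).1 h).add ((hy a).1 h), fun h => by
      rw [Finsupp.add_apply, (hx a).2 h, (hy a).2 h, add_zero]⟩
  smul_mem' := fun c x hx a =>
    ⟨fun h => (homogeneousSubmodule (Fin 3) K _).smul_mem c ((hx a).1 h), fun h => by
      rw [Finsupp.smul_apply, (hx a).2 h, smul_zero]⟩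

/-- The component of degree `t` of an element of a graded free module. -/
noncomputable def component (e : ι → ℕ) (t : ℕ) (x : ι →₀ Coord K) : ι →₀ Coord K :=
  Finsupp.onFinset x.support
    (fun a => if e a ≤ t then homogeneousComponent (t - e a) (x a) else 0) fun a ha => by
      rw [Finsupp.mem_support_iff]
      rintro h
      simp [h] at ha

lemma component_apply (e : ι → ℕ) (t : ℕ) (x : ι →₀ Coord K) (a : ι) :
    component e t x a = if e a ≤ t then homogeneousComponent (t - e a) (x a) else 0 := rfl

lemma component_zero (e : ι → ℕ) (t : ℕ) : component e t (0 : ι →₀ Coord K) = 0 := by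
  ext1 a
  simp [component_apply]

lemma component_add (e : ι → ℕ) (t : ℕ) (x y : ι →₀ Coord K) :
    component e t (x + y) = component e t x + component e t y := by
  ext1 a
  simp only [component_apply, Finsupp.add_apply, map_add]
  split_ifs <;> simp

lemma component_single (e : ι → ℕ) (t : ℕ) (a : ι) (p : Coord K) :
    component e t (Finsupp.single a p) =
      Finsupp.single a (if e a ≤ t then homogeneousComponent (t - e a) p else 0) := by
  classical
  ext1 b
  rw [component_apply, Finsupp.single_apply, Finsupp.single_apply]
  by_cases h : a = b
  · subst h
    simp
  · simp [h]

lemma component_mem (e : ι → ℕ) (t : ℕ) (x : ι →₀ Coord K) :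
    component e t x ∈ degreePart K e t := fun a => by
  rw [component_apply]
  refine ⟨fun h => ?_, fun h => if_neg (not_le.2 h)⟩
  rw [if_pos h]
  exact homogeneousComponent_isHomogeneous _ _

lemma component_eq_self {e : ι → ℕ} {t : ℕ} {x : ι →₀ Coord K} (hx : x ∈ degreePart K e t) :
    component e t x = x := by
  ext1 a
  rw [component_apply]
  split_ifs with h
  · exact homogeneousComponent_eq_self ((hx a).1 h)
  · exact ((hx a).2 (not_le.1 h)).symm

lemma linearCombination_component {e : ι → ℕ} {g : ι → Coord K}
    (hg : ∀ a, (g a).IsHomogeneous (e a)) (t : ℕ) (x : ι →₀ Coord K) :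
    Finsupp.linearCombination (Coord K) g (component e t x) =
      homogeneousComponent t (Finsupp.linearCombination (Coord K) g x) := by
  induction x using Finsupp.induction_linear with
  | zero => simp [component_zero]
  | add x y hx hy => rw [component_add, map_add, map_add, map_add, hx, hy]
  | single a p =>
    rw [component_single, Finsupp.linearCombination_single, Finsupp.linearCombination_single,
      smul_eq_mul, smul_eq_mul, homogeneousComponent_mul_of_isHomogeneous (hg a), ite_mul, zero_mul]

lemma linearCombination_component_syzygy {e : ι → ℕ} {e' : κ → ℕ} {s : κ → ι →₀ Coord K}
    (hs : ∀ b a, s b a = 0 ∨ (e a < e' b ∧ (s b a).IsHomogeneous (e' b - e a))) (t : ℕ)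
    (z : κ →₀ Coord K) :
    Finsupp.linearCombination (Coord K) s (component e' t z) =
      component e t (Finsupp.linearCombination (Coord K) s z) := by
  induction z using Finsupp.induction_linear with
  | zero => simp [component_zero]
  | add x y hx hy => rw [component_add, map_add, map_add, component_add, hx, hy]
  | single b p =>
    rw [component_single, Finsupp.linearCombination_single, Finsupp.linearCombination_single]
    ext1 a
    rw [component_apply, Finsupp.smul_apply, Finsupp.smul_apply, smul_eq_mul, smul_eq_mul]
    rcases hs b a with h | ⟨h1, h2⟩
    · simp [h]
    · rw [homogeneousComponent_mul_of_isHomogeneous h2, ite_mul, zero_mul]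
      by_cases hb : e' b ≤ t
      · rw [if_pos hb, if_pos (by omega), if_pos (by omega),
          show t - e a - (e' b - e a) = t - e' b by omega]
      · rw [if_neg hb]
        split_ifs <;> first | rfl | omega

/-- The graded free module with basis in degrees `j`, `ν j` times, in degree `t`. -/
noncomputable def degreePartEquiv (ν : ℕ → ℕ) (t : ℕ) :
    degreePart K (Sigma.fst : (Σ j : ℕ, Fin (ν j)) → ℕ) t ≃ₗ[K]
      ((j : Fin (t + 1)) → Fin (ν j) → homogeneousSubmodule (Fin 3) K (t - j)) := by
  refine LinearEquiv.ofBijective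
    { toFun := fun x j k => ⟨x.1 ⟨j, k⟩, (x.2 ⟨j, k⟩).1 (Nat.lt_succ_iff.1 j.2)⟩
      map_add' := fun x y => rfl
      map_smul' := fun c x => rfl } ⟨?_, ?_⟩
  · rintro ⟨x, hx⟩ ⟨y, hy⟩ h
    refine Subtype.ext (Finsupp.ext ?_)
    rintro ⟨j, k⟩
    rcases le_or_gt j t with hj | hj
    · exact congrArg Subtype.val (congrFun (congrFun h ⟨j, Nat.lt_succ_of_le hj⟩) k)
    · exact ((hx ⟨j, k⟩).2 hj).trans ((hy ⟨j, k⟩).2 hj).symm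
  · intro y
    refine ⟨⟨Finsupp.onFinset ((Finset.range (t + 1)).sigma fun j => Finset.univ)
      (fun a => if h : a.1 < t + 1 then (y ⟨a.1, h⟩ a.2 : Coord K) else 0) fun a ha => ?_,
        fun a => ⟨fun h => ?_, fun h => ?_⟩⟩, ?_⟩
    · by_contra h
      simp only [Finset.mem_sigma, Finset.mem_range, Finset.mem_univ, and_true] at h
      exact ha (dif_neg h)
    · rw [Finsupp.onFinset_apply, dif_pos (Nat.lt_succ_of_le h)]
      exact (y ⟨a.1, Nat.lt_succ_of_le h⟩ a.2).2
    · rw [Finsupp.onFinset_apply, dif_neg (by omega)]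
    · funext j k
      refine Subtype.ext ?_
      exact dif_pos j.2

instance finiteDimensional_degreePart (ν : ℕ → ℕ) (t : ℕ) :
    FiniteDimensional K (degreePart K (Sigma.fst : (Σ j : ℕ, Fin (ν j)) → ℕ) t) :=
  (degreePartEquiv ν t).symm.finiteDimensional

lemma finrank_degreePart (ν : ℕ → ℕ) (t : ℕ) :
    finrank K (degreePart K (Sigma.fst : (Σ j : ℕ, Fin (ν j)) → ℕ) t) =
      ∑ j ∈ Finset.range (t + 1), ν j * (t - j + 2).choose 2 := by
  rw [(degreePartEquiv ν t).finrank_eq, finrank_pi_fintype,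
    ← Fin.sum_univ_eq_sum_range (fun j => ν j * (t - j + 2).choose 2)]
  refine Finset.sum_congr rfl fun j _ => ?_
  rw [finrank_pi_fintype, Finset.sum_congr rfl fun _ _ => finrank_homogeneousSubmodule _,
    Finset.sum_const, Finset.card_univ, Fintype.card_fin, smul_eq_mul]

/-- The dimension count in degree `t` along a resolution. -/
lemma finrank_forms_add_sum {I : Ideal (Coord K)} {ν σ : ℕ → ℕ} (h : HasGradedBetti I ν σ)
    (t : ℕ) :
    finrank K (forms I t) + ∑ j ∈ Finset.range (t + 1), σ j * (t - j + 2).choose 2 =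
      ∑ j ∈ Finset.range (t + 1), ν j * (t - j + 2).choose 2 := by
  obtain ⟨g, s, h⟩ := hasGradedBetti_iff.1 h
  let D := degreePart K (Sigma.fst : (Σ j : ℕ, Fin (ν j)) → ℕ) t
  let D' := degreePart K (Sigma.fst : (Σ j : ℕ, Fin (σ j)) → ℕ) t
  let φ : D →ₗ[K] Coord K :=
    ((Finsupp.linearCombination (Coord K) g).restrictScalars K).domRestrict D
  let ψ := (Finsupp.linearCombination (Coord K) s).restrictScalars K
  have hφ : ∀ x : D, φ x = Finsupp.linearCombination (Coord K) g x := fun _ => rfl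
  have hψ : ∀ z, ψ z = Finsupp.linearCombination (Coord K) s z := fun _ => rfl
  have hrange : φ.range = forms I t := by
    apply le_antisymm
    · rintro _ ⟨x, rfl⟩
      constructor
      · change φ x ∈ I
        rw [← h.span_eq, hφ]
        exact (Finsupp.range_linearCombination (Coord K) (v := g)).le ⟨_, rfl⟩
      · change (φ x).IsHomogeneous t
        rw [hφ, ← component_eq_self x.2, linearCombination_component h.isHomogeneous]
        exact homogeneousComponent_isHomogeneous _ _
    · rintro f ⟨hf, hft⟩
      have hf' : f ∈ Submodule.span (Coord K) (Set.range g) := by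
        rw [← Ideal.span, h.span_eq]
        exact hf
      rw [← Finsupp.range_linearCombination] at hf'
      obtain ⟨x, rfl⟩ := hf'
      refine ⟨⟨component _ t x, component_mem _ t x⟩, ?_⟩
      rw [hφ]
      change Finsupp.linearCombination (Coord K) g (component _ t x) = _
      rw [linearCombination_component h.isHomogeneous, homogeneousComponent_eq_self hft]
  have hker : φ.ker.map D.subtype = D'.map ψ := by
    apply le_antisymm
    · rintro _ ⟨x, hx, rfl⟩
      have hx' : Finsupp.linearCombination (Coord K) g x = 0 := hx
      rw [h.exact, ← Finsupp.range_linearCombination] at hx'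
      obtain ⟨z, hz⟩ := hx'
      refine ⟨component _ t z, component_mem _ t z, ?_⟩
      rw [hψ, linearCombination_component_syzygy h.entry, hz, component_eq_self x.2]
      rfl
    · rintro _ ⟨z, hz, rfl⟩
      have hzD : ψ z ∈ D := by
        rw [hψ, ← component_eq_self hz, linearCombination_component_syzygy h.entry]
        exact component_mem _ _ _
      refine ⟨⟨ψ z, hzD⟩, ?_, rfl⟩
      change Finsupp.linearCombination (Coord K) g (ψ z) = 0
      rw [h.exact, ← Finsupp.range_linearCombination]
      exact ⟨z, rfl⟩
  have hinj : Function.Injective ψ := h.linearIndependent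
  have h1 := LinearMap.finrank_range_add_finrank_ker (K := K) (V := D) (V₂ := Coord K) φ
  rw [hrange, ← Submodule.finrank_map_subtype_eq D φ.ker, hker,
    ← (D'.equivMapOfInjective ψ hinj).finrank_eq, finrank_degreePart, finrank_degreePart] at h1
  exact h1

/-- The number `ν t` of minimal generators of degree `t` is the dimension of the image of `I_t` in
`R / 𝔪 I`, with `𝔪` the ideal of the polynomials without constant term. -/
lemma finrank_generators {I : Ideal (Coord K)} {ν σ : ℕ → ℕ} (h : HasGradedBetti I ν σ) (t : ℕ) :
    finrank K ((forms I t).map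
      ((RingHom.ker (constantCoeff : Coord K →+* K) * I).restrictScalars K).mkQ) = ν t := by
  obtain ⟨g, s, h⟩ := hasGradedBetti_iff.1 h
  set m : Ideal (Coord K) := RingHom.ker (constantCoeff : Coord K →+* K) with hm
  set π := ((m * I).restrictScalars K).mkQ with hπ
  have hπ0 : ∀ f, π f = 0 ↔ f ∈ m * I := fun f => by
    rw [hπ, Submodule.mkQ_apply, Submodule.Quotient.mk_eq_zero, Submodule.restrictScalars_mem]
  have hpos : ∀ (p : Coord K) (n : ℕ), 0 < n → p.IsHomogeneous n → p ∈ m := fun p n hn hp => by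
    rw [hm, RingHom.mem_ker, constantCoeff_eq]
    exact hp.coeff_eq_zero (by simpa using hn.ne)
  -- Minimality: the relations among the generators have coefficients in the maximal ideal.
  have hsyz : ∀ x, Finsupp.linearCombination (Coord K) g x = 0 → ∀ a, x a ∈ m := by
    intro x hx a
    rw [h.exact] at hx
    have hle : Submodule.span (Coord K) (Set.range s) ≤
        Submodule.comap (Finsupp.lapply a : _ →ₗ[Coord K] Coord K) m := by
      rw [Submodule.span_le]
      rintro _ ⟨b, rfl⟩
      change s b a ∈ m
      rcases h.entry b a with h0 | ⟨h1, h2⟩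
      · rw [h0]
        exact m.zero_mem
      · exact hpos _ _ (Nat.sub_pos_of_lt h1) h2
    exact hle hx
  have hli : LinearIndependent K fun k : Fin (ν t) => π (g ⟨t, k⟩) := by
    rw [Fintype.linearIndependent_iff]
    intro c hc k
    have h1 : ∑ k, c k • g ⟨t, k⟩ ∈ m * I := by
      rw [← hπ0, map_sum, ← hc]
      exact Finset.sum_congr rfl fun k _ => map_smul _ _ _
    rw [← h.span_eq, ← smul_eq_mul, Ideal.span, Submodule.mem_ideal_smul_span_iff_exists_sum] at h1
    obtain ⟨y, hy, hyg⟩ := h1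
    set x : (Σ j : ℕ, Fin (ν j)) →₀ Coord K := ∑ k, Finsupp.single ⟨t, k⟩ (C (c k)) with hx
    have h2 : Finsupp.linearCombination (Coord K) g (x - y) = 0 := by
      rw [map_sub, Finsupp.linearCombination_apply (l := y), hyg, hx, map_sum, sub_eq_zero]
      refine Finset.sum_congr rfl fun k _ => ?_
      rw [Finsupp.linearCombination_single, smul_eq_mul, smul_eq_C_mul]
    have h3 : x ⟨t, k⟩ = C (c k) := by
      rw [hx, Finsupp.finsetSum_apply, Finset.sum_eq_single k]
      · simp
      · intro k' _ hk'
        refine Finsupp.single_eq_of_ne ?_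
        rintro e
        exact hk' (by simpa using e.symm)
      · simp
    have h4 : C (c k) ∈ m := by
      have := m.add_mem (hsyz _ h2 ⟨t, k⟩) (hy ⟨t, k⟩)
      rwa [Finsupp.sub_apply, sub_add_cancel, h3] at this
    rwa [hm, RingHom.mem_ker, constantCoeff_C] at h4
  have hspan : (forms I t).map π = Submodule.span K (Set.range fun k => π (g ⟨t, k⟩)) := by
    have hgI : ∀ a, g a ∈ I := fun a => by
      rw [← h.span_eq]
      exact Ideal.subset_span ⟨a, rfl⟩
    apply le_antisymm
    · rintro _ ⟨f, ⟨hf, hft⟩, rfl⟩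
      have hf' : f ∈ Submodule.span (Coord K) (Set.range g) := by
        rw [← Ideal.span, h.span_eq]
        exact hf
      rw [← Finsupp.range_linearCombination] at hf'
      obtain ⟨x, rfl⟩ := hf'
      rw [← homogeneousComponent_eq_self hft, ← linearCombination_component h.isHomogeneous,
        Finsupp.linearCombination_apply, Finsupp.sum, map_sum]
      refine Submodule.sum_mem _ fun a _ => ?_
      rw [component_apply, smul_eq_mul]
      obtain ⟨j, k⟩ := a
      rcases lt_trichotomy j t with hj | rfl | hj
      · have : π ((if j ≤ t then homogeneousComponent (t - j) (x ⟨j, k⟩) else 0) *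
            g ⟨j, k⟩) = 0 := by
          rw [hπ0, if_pos hj.le]
          exact Ideal.mul_mem_mul (hpos _ _ (Nat.sub_pos_of_lt hj)
            (homogeneousComponent_isHomogeneous _ _)) (hgI _)
        exact this ▸ Submodule.zero_mem _
      · simp only [le_refl, if_true, Nat.sub_self, homogeneousComponent_zero, ← smul_eq_C_mul,
          map_smul]
        exact Submodule.smul_mem _ _ (Submodule.subset_span ⟨k, rfl⟩)
      · simp only [if_neg (not_le.2 hj), zero_mul, map_zero]
        exact Submodule.zero_mem _
    · rw [Submodule.span_le]
      rintro _ ⟨k, rfl⟩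
      exact ⟨g ⟨t, k⟩, ⟨hgI _, h.isHomogeneous _⟩, rfl⟩
  rw [hspan, finrank_span_eq_card hli, Fintype.card_fin]

/-- The graded Betti numbers of an ideal are unique. -/
lemma HasGradedBetti.unique {I : Ideal (Coord K)} {ν σ ν' σ' : ℕ → ℕ} (h : HasGradedBetti I ν σ)
    (h' : HasGradedBetti I ν' σ') : ν' = ν ∧ σ' = σ := by
  obtain rfl : ν' = ν := funext fun t => by rw [← finrank_generators h, ← finrank_generators h']
  refine ⟨rfl, funext fun t => ?_⟩
  induction t using Nat.strong_induction_on with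
  | _ t ih =>
    have h1 := (finrank_forms_add_sum h t).trans (finrank_forms_add_sum h' t).symm
    rw [Finset.sum_range_succ, Finset.sum_range_succ, Nat.sub_self,
      Finset.sum_congr rfl fun j hj => by rw [← ih j (Finset.mem_range.1 hj)]] at h1
    simp only [zero_add, Nat.choose_self, mul_one] at h1
    omega

end

end FatPoints

theorem theorem1p1 :
    (∀ (K : Type u) [Field K] [IsAlgClosed K] (Z : FatPoints.FatPointScheme K) (r : ℕ)
        (L : Fin r → FatPoints.Line K) (d : Fin r → ℕ),
        FatPoints.IsFullReductionVector Z L d →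
          (∀ t : ℕ, FatPoints.lowerBound d t ≤ Z.hilb t ∧ Z.hilb t ≤ FatPoints.upperBound d t) ∧
          (Antitone d → (∀ i, 0 < d i) →
            ¬ FatPoints.HasTripleRun d → ¬ FatPoints.HasStairRun d →
              FatPoints.lowerBound d = FatPoints.upperBound d)) ∧
    (∀ (r : ℕ) (d : Fin r → ℕ), StrictAnti d → (∀ i, 0 < d i) →
      ∃ ν σ : ℕ → ℕ,
        ∀ (K : Type u) [Field K] [IsAlgClosed K] (Z : FatPoints.FatPointScheme K)
          (L : Fin r → FatPoints.Line K),
          FatPoints.IsFullReductionVector Z L d →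
            ∀ ν' σ' : ℕ → ℕ, FatPoints.HasGradedBetti Z.ideal ν' σ' ↔ ν' = ν ∧ σ' = σ) := by
  refine ⟨fun K _ _ Z r L d h => ?_, fun r d hd hpos =>
    ⟨fun t => Fintype.card {a // FatPoints.generatorDegree d a = t},
      fun t => Fintype.card {b // FatPoints.syzygyDegree d b = t}, fun K _ _ Z L h ν' σ' => ?_⟩⟩
  · exact ⟨fun t => ⟨FatPoints.lowerBound_le_hilb h t, FatPoints.hilb_le_upperBound h t⟩,
      fun hd _ h3 hs => FatPoints.lowerBound_eq_upperBound hd h3 hs⟩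
  · have hb := FatPoints.hasGradedBetti_of_strictAnti h hd hpos
    exact ⟨fun h' => hb.unique h', fun ⟨h1, h2⟩ => h1 ▸ h2 ▸ hb⟩
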